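/- Let $G$ be a discrete group. A Fell bundle $\mathcal B=(B_g)_{g\in G}$ over $G$ is a family of complex Banach spaces with an associative multiplication, bilinear $B_g\times B_h\to B_{gh}$ with $\|ab\|\le\|a\|\|b\|$, and an involutive, anti-multiplicative, fibrewise conjugate-linear isometric map $a\mapsto a^*$ from $B_g$ to $B_{g^{-1}}$, such that for all $a\in B_g$ one has $\|a^*a\|=\|a\|^2$ and $a^*a\ge 0$ in the unit fibre $B_e$ (which is a $C^*$-algebra). Let $C_c(\mathcal B)$ be the $*$-algebra of finitely supported sections of $\mathcal B$, with $(f_1*f_2)(h)=\sum_{g}f_1(g)f_2(g^{-1}h)$ and $f^*(h)=f(h^{-1})^*$. The full cross-sectional $C^*$-algebra $C^*(\mathcal B)$ is the completion of $C_c(\mathcal B)$ in the norm $\|f\|_{\rm u}=\sup\{p(f): p \text{ a } C^*\text{-seminorm on } C_c(\mathcal B)\}$; let $\kappa:C_c(\mathcal B)\to C^*(\mathcal B)$ be the canonical map. Let $\ell^2(\mathcal B)$ be the right Hilbert $B_e$-module obtained by completing $C_c(\mathcal B)$ with respect to the inner product $\langle f_1,f_2\rangle=\sum_{h}f_1(h)^*f_2(h)$,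 and let $\iota:C_c(\mathcal B)\to\mathcal L_{B_e}(\ell^2(\mathcal B))$ be the $*$-representation by adjointable operators given by $\iota(f)=\sum_g\lambda_g(f(g))$, where $(\lambda_g(a)f)(h)=a\,f(g^{-1}h)$ for $a\in B_g$, $f\in C_c(\mathcal B)$, $h\in G$. The reduced cross-sectional $C^*$-algebra $C_r^*(\mathcal B)$ is the $C^*$-subalgebra of $\mathcal L_{B_e}(\ell^2(\mathcal B))$ generated by $\iota(C_c(\mathcal B))$. Let $\Lambda:C^*(\mathcal B)\to C_r^*(\mathcal B)$ be the canonical $*$-homomorphism, determined by $\Lambda\circ\kappa=\iota$. The bundle $\mathcal B$ has the weak containment property if $\Lambda$ is injective. A $\mathcal B$-bundle map is a family $T=(T_g)_{g\in G}$ of bounded linear maps $T_g:B_g\to B_g$; it is positive definite if $$\sum_{i,j=1}^n b_i\,T_{g_i^{-1}g_j}(a_i^*a_j)\,b_j^*\ \ge 0\quad\text{in } B_e$$ for all $n\in\mathbb N$, $g_1,\dots,g_n\in G$ and $a_i,b_i\in B_{g_i}$. The bundle $\mathcal B$ has the PD-approximation property if there is a net $(T^i)_{i\in I}$ of $\mathcal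 B$-bundle maps such that (i) each $T^i$ is positive definite with finite support $\{g\in G: T^i_g\ne0\}$; (ii) $\sup_i\|T^i_e\|<\infty$; (iii) $\lim_i\|T^i_g(b)-b\|=0$ for every $g\in G$ and $b\in B_g$. **Theorem.** If a Fell bundle $\mathcal B$ over a discrete group $G$ has the PD-approximation property, then $\mathcal B$ has the weak containment property. Hence the canonical map $\Lambda:C^*(\mathcal B)\to C_r^*(\mathcal B)$ is an isomorphism of $C^*$-algebras. -/

import Mathlib

universe u v w

noncomputable section

/-- A C⋆-seminorm on a complex ⋆-algebra. -/
structure CStarSeminorm (R : Type*) [NonUnitalRing R] [StarRing R] [Module ℂ R]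
    extends Seminorm ℂ R where
  mul_le' : ∀ x y, toFun (x * y) ≤ toFun x * toFun y
  star' : ∀ x, toFun (star x) = toFun x
  star_mul_self' : ∀ x, toFun (star x * x) = toFun x ^ 2

namespace CStarSeminorm

open UniformSpace

variable {R : Type*} [NonUnitalRing R] [StarRing R] [Module ℂ R]

/-- The value of a C⋆-seminorm. -/
instance : CoeFun (CStarSeminorm R) (fun _ => R → ℝ) := ⟨fun p => p.toSeminorm⟩

/-- The algebra `R`, regarded as a seminormed space with the seminorm `p`. -/
def Carrier (_p : CStarSeminorm R) : Type _ := R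

variable (p : CStarSeminorm R)

instance : NonUnitalRing p.Carrier := inferInstanceAs (NonUnitalRing R)
instance : StarRing p.Carrier := inferInstanceAs (StarRing R)
instance : Module ℂ p.Carrier := inferInstanceAs (Module ℂ R)
instance [IsScalarTower ℂ R R] : IsScalarTower ℂ p.Carrier p.Carrier :=
  inferInstanceAs (IsScalarTower ℂ R R)
instance [SMulCommClass ℂ R R] : SMulCommClass ℂ p.Carrier p.Carrier :=
  inferInstanceAs (SMulCommClass ℂ R R)
instance [StarModule ℂ R] : StarModule ℂ p.Carrier := inferInstanceAs (StarModule ℂ R)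

instance : NonUnitalSeminormedRing p.Carrier :=
  { (inferInstance : NonUnitalRing p.Carrier),
    AddGroupSeminorm.toSeminormedAddCommGroup (E := p.Carrier)
      (show AddGroupSeminorm R from p.toAddGroupSeminorm) with
    norm_mul_le := fun x y => p.mul_le' x y }

theorem norm_carrier (x : R) : ‖(show p.Carrier from x)‖ = p x := rfl

instance : NormedSpace ℂ p.Carrier where
  norm_smul_le c x := (map_smul_eq_mul p.toSeminorm c x).le

instance : NormedStarGroup p.Carrier where
  norm_star_le x := (p.star' x).le

/-- The completion of `R` with respect to the C⋆-seminorm `p` (the null space of `p` is divided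
out, the completion being Hausdorff). -/
abbrev Completion : Type _ := UniformSpace.Completion p.Carrier

/-- The canonical map of `R` into its completion. -/
def toCompletion (x : R) : p.Completion := ((show p.Carrier from x) : UniformSpace.Completion _)

instance : Mul p.Completion :=
  ⟨Function.curry <| (Completion.isDenseInducing_coe.prodMap Completion.isDenseInducing_coe).extend
    ((↑) ∘ Function.uncurry ((· * ·) : p.Carrier → p.Carrier → p.Carrier))⟩

theorem coe_mul (a b : p.Carrier) : ((a * b : p.Carrier) : p.Completion) = a * b :=
  ((Completion.isDenseInducing_coe.prodMap Completion.isDenseInducing_coe).extend_eq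
      ((Completion.continuous_coe p.Carrier).comp continuous_mul) (a, b)).symm

instance : ContinuousMul p.Completion where
  continuous_mul := by
    let m := (AddMonoidHom.mul : p.Carrier →+ p.Carrier →+ p.Carrier).compr₂ Completion.toCompl
    have : Continuous fun q : p.Carrier × p.Carrier => m q.1 q.2 :=
      (Completion.continuous_coe p.Carrier).comp continuous_mul
    have di : IsDenseInducing (Completion.toCompl : p.Carrier → p.Completion) :=
      Completion.isDenseInducing_coe
    exact (di.extend_Z_bilin di this :)

instance : Star p.Completion := ⟨Completion.map (star : p.Carrier → p.Carrier)⟩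

theorem uniformContinuous_star : UniformContinuous (star : p.Carrier → p.Carrier) :=
  star_isometry.uniformContinuous

theorem coe_star (a : p.Carrier) : ((star a : p.Carrier) : p.Completion) = star (a : p.Completion) :=
  (Completion.map_coe p.uniformContinuous_star a).symm

theorem continuous_star' : Continuous (star : p.Completion → p.Completion) :=
  Completion.continuous_map

instance : ContinuousStar p.Completion := ⟨p.continuous_star'⟩

instance : NonUnitalNormedRing p.Completion :=
  { (inferInstance : NormedAddCommGroup p.Completion), (inferInstance : Mul p.Completion) with
    zero_mul a := Completion.induction_on a (isClosed_eq (by fun_prop) continuous_const)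
        fun a => by rw [← Completion.coe_zero, ← coe_mul, zero_mul]
    mul_zero a := Completion.induction_on a (isClosed_eq (by fun_prop) continuous_const)
        fun a => by rw [← Completion.coe_zero, ← coe_mul, mul_zero]
    mul_assoc a b c :=
      Completion.induction_on₃ a b c (isClosed_eq (by fun_prop) (by fun_prop))
        fun a b c => by rw [← coe_mul, ← coe_mul, ← coe_mul, ← coe_mul, mul_assoc]
    left_distrib a b c :=
      Completion.induction_on₃ a b c (isClosed_eq (by fun_prop) (by fun_prop))
        fun a b c => by
          rw [← Completion.coe_add, ← coe_mul, ← coe_mul, ← coe_mul, ← Completion.coe_add, mul_add]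
    right_distrib a b c :=
      Completion.induction_on₃ a b c (isClosed_eq (by fun_prop) (by fun_prop))
        fun a b c => by
          rw [← Completion.coe_add, ← coe_mul, ← coe_mul, ← coe_mul, ← Completion.coe_add, add_mul]
    norm_mul_le a b :=
      Completion.induction_on₂ a b (isClosed_le (by fun_prop) (by fun_prop))
        fun a b => by
          rw [← coe_mul, Completion.norm_coe, Completion.norm_coe, Completion.norm_coe]
          exact norm_mul_le a b }

instance : StarRing p.Completion where
  star_involutive a := Completion.induction_on a (isClosed_eq (by fun_prop) (by fun_prop))
    fun a => by rw [← coe_star, ← coe_star, star_star]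
  star_mul a b := Completion.induction_on₂ a b (isClosed_eq (by fun_prop) (by fun_prop))
    fun a b => by rw [← coe_mul, ← coe_star, ← coe_star, ← coe_star, ← coe_mul, star_mul]
  star_add a b := Completion.induction_on₂ a b (isClosed_eq (by fun_prop) (by fun_prop))
    fun a b => by
      rw [← Completion.coe_add, ← coe_star, ← coe_star, ← coe_star, ← Completion.coe_add, star_add]

instance : CStarRing p.Completion where
  norm_mul_self_le a := Completion.induction_on a (isClosed_le (by fun_prop) (by fun_prop))
    fun a => by
      rw [← coe_star, ← coe_mul, Completion.norm_coe, Completion.norm_coe, ← sq]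
      exact (p.star_mul_self' a).ge

instance [IsScalarTower ℂ R R] : IsScalarTower ℂ p.Completion p.Completion where
  smul_assoc c a b := by
    change (c • a) * b = c • (a * b)
    exact Completion.induction_on₂ a b (isClosed_eq ((continuous_fst.const_smul c).mul continuous_snd)
      ((continuous_fst.mul continuous_snd).const_smul c)) fun a b => by
      rw [← Completion.coe_smul, ← coe_mul, ← coe_mul, ← Completion.coe_smul, smul_mul_assoc]

instance [SMulCommClass ℂ R R] : SMulCommClass ℂ p.Completion p.Completion where
  smul_comm c a b := by
    change c • (a * b) = a * (c • b)
    exact Completion.induction_on₂ a b (isClosed_eq ((continuous_fst.mul continuous_snd).const_smul c)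
      (continuous_fst.mul (continuous_snd.const_smul c))) fun a b => by
      rw [← Completion.coe_smul, ← coe_mul, ← coe_mul, ← Completion.coe_smul, mul_smul_comm]

instance [StarModule ℂ R] : StarModule ℂ p.Completion where
  star_smul c a := Completion.induction_on a (isClosed_eq (continuous_star.comp
      (continuous_const_smul c)) (continuous_star.const_smul (star c)))
    fun a => by
      rw [← Completion.coe_smul, ← coe_star, ← coe_star, ← Completion.coe_smul, star_smul]

/-- The completion of a ⋆-algebra with respect to a C⋆-seminorm is a C⋆-algebra. -/
instance [IsScalarTower ℂ R R] [SMulCommClass ℂ R R] [StarModule ℂ R] :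
    NonUnitalCStarAlgebra p.Completion where

/-- The canonical map of `R` into its completion as a ⋆-homomorphism. -/
def toCompletionHom : R →⋆ₙₐ[ℂ] p.Completion where
  toFun := p.toCompletion
  map_smul' c x := Completion.coe_smul c (show p.Carrier from x)
  map_zero' := Completion.coe_zero
  map_add' x y := Completion.coe_add (show p.Carrier from x) (show p.Carrier from y)
  map_mul' x y := p.coe_mul (show p.Carrier from x) (show p.Carrier from y)
  map_star' x := p.coe_star (show p.Carrier from x)

theorem norm_toCompletionHom (x : R) : ‖p.toCompletionHom x‖ = p x :=
  Completion.norm_coe (show p.Carrier from x)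

theorem denseRange_toCompletionHom : DenseRange p.toCompletionHom :=
  Completion.denseRange_coe (α := p.Carrier)

/-- A ⋆-homomorphism into a C⋆-algebra that is dominated by `p` extends to the completion. -/
def lift {D : Type*} [NonUnitalCStarAlgebra D] (φ : R →⋆ₙₐ[ℂ] D) (h : ∀ x, ‖φ x‖ ≤ p x) :
    p.Completion →⋆ₙₐ[ℂ] D :=
  let φ' : p.Carrier →L[ℂ] D :=
    LinearMap.mkContinuous (show R →ₗ[ℂ] D from
      { toFun := φ, map_add' := map_add φ, map_smul' := map_smul φ }) 1
      (fun x => by rw [one_mul]; exact h x)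
  { toFun := φ'.fromCompletion
    map_smul' := map_smul φ'.fromCompletion
    map_zero' := map_zero φ'.fromCompletion
    map_add' := map_add φ'.fromCompletion
    map_mul' := fun a b => Completion.induction_on₂ a b
      (isClosed_eq (by fun_prop) (by fun_prop)) fun a b => by
        rw [← coe_mul, ContinuousLinearMap.fromCompletion_apply_coe,
          ContinuousLinearMap.fromCompletion_apply_coe,
          ContinuousLinearMap.fromCompletion_apply_coe]
        exact map_mul φ a b
    map_star' := fun a => Completion.induction_on a
      (isClosed_eq (by fun_prop) (by fun_prop)) fun a => by
        rw [← coe_star, ContinuousLinearMap.fromCompletion_apply_coe,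
          ContinuousLinearMap.fromCompletion_apply_coe]
        exact map_star φ a }

theorem lift_toCompletionHom {D : Type*} [NonUnitalCStarAlgebra D] (φ : R →⋆ₙₐ[ℂ] D)
    (h : ∀ x, ‖φ x‖ ≤ p x) (x : R) : p.lift φ h (p.toCompletionHom x) = φ x :=
  ContinuousLinearMap.fromCompletion_apply_coe _ _

end CStarSeminorm

/-- A Fell bundle over the (discrete) group `G`. To avoid transporting along equalities of group
elements, the multiplication `B_g × B_h → B_{gh}` is given for every `k` with a proof of `g * h = k`
as a map into `B_k`, and the involution `B_g → B_{g⁻¹}` for every `k` with a proof of `g⁻¹ = k` as a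
map into `B_k`. The last axiom says that `b* b` is a positive element `c* c` of the unit fibre. -/
structure FellBundle (G : Type u) [Group G] where
  Fib : G → Type v
  [normedAddCommGroup : ∀ g, NormedAddCommGroup (Fib g)]
  [normedSpace : ∀ g, NormedSpace ℂ (Fib g)]
  [completeSpace : ∀ g, CompleteSpace (Fib g)]
  mul : ∀ {g h k : G}, g * h = k → Fib g →ₗ[ℂ] Fib h →ₗ[ℂ] Fib k
  inv : ∀ {g k : G}, g⁻¹ = k → Fib g →ₗ⋆[ℂ] Fib k
  mul_assoc : ∀ {g h k gh hk l : G} (p : g * h = gh) (q : gh * k = l) (r : h * k = hk)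
    (s : g * hk = l) (a : Fib g) (b : Fib h) (c : Fib k),
    mul q (mul p a b) c = mul s a (mul r b c)
  norm_mul_le : ∀ {g h k : G} (p : g * h = k) (a : Fib g) (b : Fib h),
    ‖mul p a b‖ ≤ ‖a‖ * ‖b‖
  inv_inv : ∀ {g k : G} (p : g⁻¹ = k) (q : k⁻¹ = g) (a : Fib g), inv q (inv p a) = a
  inv_mul : ∀ {g h k g' h' k' : G} (p : g * h = k) (q : k⁻¹ = k') (r : g⁻¹ = g') (s : h⁻¹ = h')
    (t : h' * g' = k') (a : Fib g) (b : Fib h),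
    inv q (mul p a b) = mul t (inv s b) (inv r a)
  norm_inv : ∀ {g k : G} (p : g⁻¹ = k) (a : Fib g), ‖inv p a‖ = ‖a‖
  norm_inv_mul_self : ∀ {g k : G} (p : g⁻¹ = k) (q : k * g = 1) (a : Fib g),
    ‖mul q (inv p a) a‖ = ‖a‖ ^ 2
  inv_mul_self_pos : ∀ {g k : G} (p : g⁻¹ = k) (q : k * g = 1) (a : Fib g),
    ∃ c : Fib 1, mul q (inv p a) a = mul (mul_one 1) (inv inv_one c) c

namespace FellBundle

attribute [instance] normedAddCommGroup normedSpace completeSpace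

variable {G : Type u} [Group G] (B : FellBundle.{u, v} G)

/-! ### The unit fibre -/

instance : Mul (B.Fib 1) := ⟨fun a b => B.mul (mul_one 1) a b⟩

instance : Star (B.Fib 1) := ⟨fun a => B.inv inv_one a⟩

theorem unit_mul_def (a b : B.Fib 1) : a * b = B.mul (mul_one 1) a b := rfl

theorem unit_star_def (a : B.Fib 1) : star a = B.inv inv_one a := rfl

instance : NonUnitalNormedRing (B.Fib 1) :=
  { B.normedAddCommGroup 1, (inferInstance : Mul (B.Fib 1)) with
    zero_mul := fun a => by simp [unit_mul_def]
    mul_zero := fun a => by simp [unit_mul_def]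
    mul_assoc := fun a b c => B.mul_assoc _ _ _ _ a b c
    left_distrib := fun a b c => by simp [unit_mul_def]
    right_distrib := fun a b c => by simp [unit_mul_def]
    norm_mul_le := fun a b => B.norm_mul_le _ a b }

instance : StarRing (B.Fib 1) where
  star_involutive a := B.inv_inv _ _ a
  star_mul a b := B.inv_mul _ _ _ _ _ a b
  star_add a b := map_add (B.inv inv_one) a b

instance : IsScalarTower ℂ (B.Fib 1) (B.Fib 1) where
  smul_assoc c a b := by
    change B.mul _ (c • a) b = c • B.mul _ a b
    simp

instance : SMulCommClass ℂ (B.Fib 1) (B.Fib 1) where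
  smul_comm c a b := by
    change c • B.mul _ a b = B.mul _ a (c • b)
    simp

instance : StarModule ℂ (B.Fib 1) where
  star_smul c a := map_smulₛₗ (B.inv inv_one) c a

instance : CStarRing (B.Fib 1) where
  norm_mul_self_le a := by
    rw [← sq]
    exact (B.norm_inv_mul_self inv_one (mul_one 1) a).ge

/-- The unit fibre is a C⋆-algebra. -/
instance : NonUnitalCStarAlgebra (B.Fib 1) where

/-- The order of the C⋆-algebra `B_e`: `x ≤ y` if `y - x` is self-adjoint with spectrum in
`[0, ∞)`. -/
instance : PartialOrder (B.Fib 1) := CStarAlgebra.spectralOrder _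

instance : StarOrderedRing (B.Fib 1) := CStarAlgebra.spectralOrderedRing _

theorem inv_mul_self_nonneg {g k : G} (p : g⁻¹ = k) (q : k * g = 1) (a : B.Fib g) :
    0 ≤ B.mul q (B.inv p a) a := by
  obtain ⟨c, hc⟩ := B.inv_mul_self_pos p q a
  rw [hc]
  exact star_mul_self_nonneg c

/-- `(a c)* (a c) ≤ ‖a‖² c* c`. -/
theorem mul_conj_le {g h m : G} (r : g * h = m) (a : B.Fib g) (c : B.Fib h) :
    B.mul (inv_mul_cancel m) (B.inv rfl (B.mul r a c)) (B.mul r a c) ≤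
      ((‖a‖ ^ 2 : ℝ) : ℂ) • B.mul (inv_mul_cancel h) (B.inv rfl c) c := by
  let _ : PartialOrder (Unitization ℂ (B.Fib 1)) := CStarAlgebra.spectralOrder _
  have _ : StarOrderedRing (Unitization ℂ (B.Fib 1)) := CStarAlgebra.spectralOrderedRing _
  set b : B.Fib 1 := B.mul (inv_mul_cancel g) (B.inv rfl a) a with hb
  have hb0 : 0 ≤ b := B.inv_mul_self_nonneg _ _ a
  have hbn : ‖b‖ = ‖a‖ ^ 2 := B.norm_inv_mul_self _ _ a
  have hsa : IsSelfAdjoint (b : Unitization ℂ (B.Fib 1)) := by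
    simpa using (IsSelfAdjoint.of_nonneg hb0)
  have h1 : (b : Unitization ℂ (B.Fib 1)) ≤ algebraMap ℝ _ (‖a‖ ^ 2) := by
    have := hsa.le_algebraMap_norm_self
    rwa [Unitization.norm_inr, hbn] at this
  obtain ⟨r', hr'⟩ := CStarAlgebra.nonneg_iff_eq_star_mul_self.1 (sub_nonneg.2 h1)
  have hfst : star r'.fst * r'.fst = ((‖a‖ ^ 2 : ℝ) : ℂ) := by
    have := congrArg (fun z => z.fst) hr'
    simpa [Unitization.algebraMap_eq_inl_comp, sub_eq_add_neg] using this.symm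
  have hsnd : star r'.fst • r'.snd + r'.fst • star r'.snd + star r'.snd * r'.snd = -b := by
    have := congrArg (fun z => z.snd) hr'
    simpa [Unitization.algebraMap_eq_inl_comp, sub_eq_add_neg] using this.symm
  set t := r'.fst
  set s := r'.snd
  have hpos := B.inv_mul_self_nonneg rfl (inv_mul_cancel h) (t • c + B.mul (one_mul h) s c)
  have e1 : B.inv rfl (B.mul (one_mul h) s c) =
      B.mul (mul_one h⁻¹) (B.inv rfl c) (star s) := B.inv_mul _ _ _ _ _ s c
  have e2 : ∀ x : B.Fib 1, B.mul (inv_mul_cancel h) (B.mul (mul_one h⁻¹) (B.inv rfl c) x) c =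
      B.mul (inv_mul_cancel h) (B.inv rfl c) (B.mul (one_mul h) x c) := fun x =>
    B.mul_assoc _ _ _ _ _ _ _
  have e3 : B.mul (inv_mul_cancel h) (B.mul (mul_one h⁻¹) (B.inv rfl c) (star s))
      (B.mul (one_mul h) s c) = B.mul (inv_mul_cancel h) (B.inv rfl c)
        (B.mul (one_mul h) (star s * s) c) := by
    rw [B.mul_assoc _ _ (one_mul h) (inv_mul_cancel h)]
    congr 1
    exact (B.mul_assoc _ _ _ _ _ _ _).symm
  have e4 : B.mul (inv_mul_cancel m) (B.inv rfl (B.mul r a c)) (B.mul r a c) =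
      B.mul (inv_mul_cancel h) (B.inv rfl c) (B.mul (one_mul h) b c) := by
    have t1 : h⁻¹ * g⁻¹ = m⁻¹ := by rw [← r, mul_inv_rev]
    have t2 : g⁻¹ * m = h := by rw [← r, inv_mul_cancel_left]
    rw [B.inv_mul r rfl rfl rfl t1, B.mul_assoc _ _ t2 (inv_mul_cancel h),
      ← B.mul_assoc (inv_mul_cancel g) (one_mul h) r t2]
  have hb' : b = -(star t • s + t • star s + star s * s) := by rw [hsnd, neg_neg]
  rw [e4, ← sub_nonneg]
  convert hpos using 1
  rw [hb', ← hfst]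
  simp only [map_add, LinearMap.add_apply, map_smulₛₗ, LinearMap.smul_apply, map_neg,
    LinearMap.neg_apply, e1, e2, e3, RingHom.id_apply, smul_add, smul_smul, starRingEnd_apply]
  rw [mul_comm (star t) t]
  abel

/-! ### The ⋆-algebra of finitely supported sections -/

/-- `C_c(B)`: the finitely supported sections of the bundle. -/
def Cc : Type (max u v) := Π₀ g, B.Fib g

instance : AddCommGroup B.Cc := inferInstanceAs (AddCommGroup (Π₀ g, B.Fib g))
instance : Module ℂ B.Cc := inferInstanceAs (Module ℂ (Π₀ g, B.Fib g))
instance : DFunLike B.Cc G B.Fib := inferInstanceAs (DFunLike (Π₀ g, B.Fib g) G B.Fib)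

variable {B} in
theorem Cc.add_apply (f₁ f₂ : B.Cc) (g : G) : (f₁ + f₂) g = f₁ g + f₂ g :=
  DFinsupp.add_apply f₁ f₂ g

variable {B} in
theorem Cc.zero_apply (g : G) : (0 : B.Cc) g = 0 := DFinsupp.zero_apply g

open scoped Classical in
/-- The section `a ⊙ g` with the value `a` at `g` and zero elsewhere. -/
def j (g : G) : B.Fib g →ₗ[ℂ] B.Cc := DFinsupp.lsingle g

theorem j_apply_same (g : G) (a : B.Fib g) : B.j g a g = a := by
  classical exact DFinsupp.single_eq_same

theorem j_apply_ne {g h : G} (hgh : g ≠ h) (a : B.Fib g) : B.j g a h = 0 := by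
  classical exact DFinsupp.single_eq_of_ne hgh.symm

theorem j_congr {g h k l : G} (p : g * h = k) (q : g * h = l) (a : B.Fib g) (b : B.Fib h) :
    B.j k (B.mul p a b) = B.j l (B.mul q a b) := by
  subst p; subst q; rfl

theorem j_inv_congr {g k l : G} (p : g⁻¹ = k) (q : g⁻¹ = l) (a : B.Fib g) :
    B.j k (B.inv p a) = B.j l (B.inv q a) := by
  subst p; subst q; rfl

variable {B} in
theorem Cc.induction {P : B.Cc → Prop} (f : B.Cc) (h0 : P 0)
    (hadd : ∀ f₁ f₂, P f₁ → P f₂ → P (f₁ + f₂)) (hj : ∀ g a, P (B.j g a)) : P f := by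
  classical
  refine DFinsupp.induction f h0 fun i b f _ _ hf => hadd _ _ ?_ hf
  convert hj i b
  simp only [j]
  congr!

open scoped Classical in
/-- The convolution `(f₁ ∗ f₂)(h) = ∑_g f₁(g) f₂(g⁻¹ h)`, given as the bilinear map which sends
`(a ⊙ g, b ⊙ h)` to `ab ⊙ gh`; see `conv_apply`. -/
def conv : B.Cc →ₗ[ℂ] B.Cc →ₗ[ℂ] B.Cc :=
  DFinsupp.lsum ℂ fun g => LinearMap.flip (DFinsupp.lsum ℂ fun h => LinearMap.flip
    ((B.mul (rfl : g * h = g * h)).compr₂ (B.j (g * h))))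

open scoped Classical in
/-- The involution `f*(h) = f(h⁻¹)*`, given as the additive map which sends `a ⊙ g` to
`a* ⊙ g⁻¹`; see `star_apply`. -/
def invol : B.Cc →+ B.Cc :=
  DFinsupp.liftAddHom fun g =>
    (B.j g⁻¹).toAddMonoidHom.comp (B.inv (rfl : g⁻¹ = g⁻¹)).toAddMonoidHom

instance : Mul B.Cc := ⟨fun f₁ f₂ => B.conv f₁ f₂⟩
instance : Star B.Cc := ⟨fun f => B.invol f⟩

theorem mul_def (f₁ f₂ : B.Cc) : f₁ * f₂ = B.conv f₁ f₂ := rfl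
theorem star_def (f : B.Cc) : star f = B.invol f := rfl

theorem j_mul_j {g h k : G} (p : g * h = k) (a : B.Fib g) (b : B.Fib h) :
    B.j g a * B.j h b = B.j k (B.mul p a b) := by
  classical
  rw [B.j_congr p rfl]
  have h1 : B.conv (B.j g a) = _ := DFinsupp.lsum_single (R := ℂ) ℂ
    (fun g => LinearMap.flip (DFinsupp.lsum ℂ fun h => LinearMap.flip
      ((B.mul (rfl : g * h = g * h)).compr₂ (B.j (g * h))))) g a
  rw [mul_def, h1]
  exact congrArg (fun φ => φ a) (DFinsupp.lsum_single (R := ℂ) ℂ (fun h => LinearMap.flip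
      ((B.mul (rfl : g * h = g * h)).compr₂ (B.j (g * h)))) h b)

theorem star_j {g k : G} (p : g⁻¹ = k) (a : B.Fib g) :
    star (B.j g a) = B.j k (B.inv p a) := by
  classical
  rw [B.j_inv_congr p rfl]
  exact DFinsupp.liftAddHom_apply_single (fun g =>
    (B.j g⁻¹).toAddMonoidHom.comp (B.inv (rfl : g⁻¹ = g⁻¹)).toAddMonoidHom) g a

instance : NonUnitalNonAssocRing B.Cc :=
  { (inferInstance : AddCommGroup B.Cc), (inferInstance : Mul B.Cc) with
    zero_mul := fun a => by simp [mul_def]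
    mul_zero := fun a => by simp [mul_def]
    left_distrib := fun a b c => by simp [mul_def]
    right_distrib := fun a b c => by simp [mul_def] }

instance : NonUnitalRing B.Cc :=
  { (inferInstance : NonUnitalNonAssocRing B.Cc) with
    mul_assoc := fun x y z => by
      induction x using Cc.induction with
      | h0 => simp
      | hadd _ _ h₁ h₂ => simp only [add_mul, h₁, h₂]
      | hj g a =>
      induction y using Cc.induction with
      | h0 => simp
      | hadd _ _ h₁ h₂ => simp only [add_mul, mul_add, h₁, h₂]
      | hj h b =>
      induction z using Cc.induction with
      | h0 => simp
      | hadd _ _ h₁ h₂ => simp only [mul_add, h₁, h₂]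
      | hj k c =>
      rw [B.j_mul_j rfl, B.j_mul_j rfl, B.j_mul_j rfl, B.j_mul_j (_root_.mul_assoc g h k).symm,
        B.mul_assoc] }

instance : StarRing B.Cc where
  star_involutive x := by
    induction x using Cc.induction with
    | h0 => simp only [star_def, map_zero]
    | hadd _ _ h₁ h₂ => simp only [star_def, map_add] at h₁ h₂ ⊢; rw [h₁, h₂]
    | hj g a =>
    rw [B.star_j rfl, B.star_j (_root_.inv_inv g), B.inv_inv]
  star_add x y := map_add B.invol x y
  star_mul x y := by
    have hadd : ∀ u v : B.Cc, star (u + v) = star u + star v := map_add B.invol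
    have h0 : star (0 : B.Cc) = 0 := map_zero B.invol
    induction x using Cc.induction with
    | h0 => simp [h0]
    | hadd _ _ h₁ h₂ => simp only [add_mul, mul_add, hadd, h₁, h₂]
    | hj g a =>
    induction y using Cc.induction with
    | h0 => simp [h0]
    | hadd _ _ h₁ h₂ => simp only [add_mul, mul_add, hadd, h₁, h₂]
    | hj h b =>
    rw [B.j_mul_j rfl, B.star_j rfl, B.star_j rfl, B.star_j rfl,
      B.j_mul_j (mul_inv_rev g h).symm, B.inv_mul]

instance : IsScalarTower ℂ B.Cc B.Cc where
  smul_assoc c x y := by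
    change B.conv (c • x) y = c • B.conv x y
    simp

instance : SMulCommClass ℂ B.Cc B.Cc where
  smul_comm c x y := by
    change c • B.conv x y = B.conv x (c • y)
    simp

instance : StarModule ℂ B.Cc where
  star_smul c x := by
    induction x using Cc.induction with
    | h0 => simp
    | hadd _ _ h₁ h₂ => simp only [smul_add, star_add, h₁, h₂]
    | hj g a =>
    rw [← map_smul, B.star_j rfl, B.star_j rfl, map_smulₛₗ, map_smul]
    rfl

theorem star_apply (f : B.Cc) (h : G) : star f h = B.inv (_root_.inv_inv h) (f h⁻¹) := by
  induction f using Cc.induction with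
  | h0 => rw [star_zero, Cc.zero_apply, Cc.zero_apply, map_zero]
  | hadd f₁ f₂ h₁ h₂ => simp only [star_add, Cc.add_apply, map_add, h₁, h₂]
  | hj g a =>
    rw [B.star_j rfl]
    by_cases hg : g = h⁻¹
    · subst hg
      rw [B.j_apply_same, B.j_inv_congr rfl (_root_.inv_inv h), B.j_apply_same]
    · rw [B.j_apply_ne hg, B.j_apply_ne (fun e => hg (by rw [← e, _root_.inv_inv])), map_zero]

theorem j_mul_apply {g : G} (a : B.Fib g) (f : B.Cc) (h : G) :
    (B.j g a * f) h = B.mul (mul_inv_cancel_left g h) a (f (g⁻¹ * h)) := by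
  induction f using Cc.induction with
  | h0 => rw [mul_zero, Cc.zero_apply, Cc.zero_apply, map_zero]
  | hadd f₁ f₂ h₁ h₂ => simp only [mul_add, Cc.add_apply, map_add, h₁, h₂]
  | hj k b =>
    rw [B.j_mul_j rfl]
    by_cases hk : k = g⁻¹ * h
    · subst hk
      rw [B.j_apply_same, B.j_congr rfl (mul_inv_cancel_left g h), B.j_apply_same]
    · rw [B.j_apply_ne hk, B.j_apply_ne (fun e => hk (by rw [← e, inv_mul_cancel_left])), map_zero]

open scoped Classical in
theorem sum_j (f : B.Cc) : ∑ g ∈ DFinsupp.support f, B.j g (f g) = f :=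
  DFinsupp.sum_single

open scoped Classical in
theorem conv_apply (f₁ f₂ : B.Cc) (h : G) :
    (f₁ * f₂) h = ∑ g ∈ DFinsupp.support f₁,
      B.mul (mul_inv_cancel_left g h) (f₁ g) (f₂ (g⁻¹ * h)) := by
  have e : (f₁ * f₂) h = ∑ g ∈ DFinsupp.support f₁, (B.j g (f₁ g) * f₂) h := by
    conv_lhs => rw [← B.sum_j f₁, Finset.sum_mul]
    exact DFinsupp.finsetSum_apply _ _ _
  rw [e]
  exact Finset.sum_congr rfl fun g _ => B.j_mul_apply _ _ _

/-! ### The full cross-sectional C⋆-algebra -/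

/-- The inclusion of the unit fibre into `C_c(B)` as a ⋆-homomorphism. -/
def jUnit : B.Fib 1 →⋆ₙₐ[ℂ] B.Cc where
  toFun := B.j 1
  map_smul' := map_smul (B.j 1)
  map_zero' := map_zero (B.j 1)
  map_add' := map_add (B.j 1)
  map_mul' a b := (B.j_mul_j (mul_one 1) a b).symm
  map_star' a := (B.star_j inv_one a).symm

theorem seminorm_j_le (p : CStarSeminorm B.Cc) {g : G} (a : B.Fib g) : p (B.j g a) ≤ ‖a‖ := by
  have h1 : ∀ b : B.Fib 1, p (B.j 1 b) ≤ ‖b‖ := fun b => by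
    have := NonUnitalStarAlgHom.norm_apply_le (p.toCompletionHom.comp B.jUnit) b
    rwa [NonUnitalStarAlgHom.comp_apply, p.norm_toCompletionHom] at this
  have h2 : p (B.j g a) ^ 2 ≤ ‖a‖ ^ 2 := by
    rw [← B.norm_inv_mul_self rfl (inv_mul_cancel g) a]
    refine le_trans (le_of_eq ?_) (h1 _)
    rw [← B.j_mul_j, ← B.star_j]
    exact (p.star_mul_self' _).symm
  exact le_of_sq_le_sq h2 (norm_nonneg a)

theorem bddAbove_seminorm (f : B.Cc) : BddAbove (Set.range fun p : CStarSeminorm B.Cc => p f) := by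
  suffices h : ∃ C, ∀ p : CStarSeminorm B.Cc, p f ≤ C by
    obtain ⟨C, hC⟩ := h
    exact ⟨C, by rintro _ ⟨p, rfl⟩; exact hC p⟩
  induction f using Cc.induction with
  | h0 => exact ⟨0, fun p => (map_zero p.toSeminorm).le⟩
  | hadd f₁ f₂ h₁ h₂ =>
    obtain ⟨C₁, h₁⟩ := h₁
    obtain ⟨C₂, h₂⟩ := h₂
    exact ⟨C₁ + C₂, fun p => (map_add_le_add p.toSeminorm f₁ f₂).trans (add_le_add (h₁ p) (h₂ p))⟩
  | hj g a => exact ⟨‖a‖, fun p => B.seminorm_j_le p a⟩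

/-- The zero seminorm. -/
def zeroSeminorm : CStarSeminorm B.Cc where
  toSeminorm := 0
  mul_le' _ _ := (mul_zero (0 : ℝ)).ge
  star' _ := rfl
  star_mul_self' _ := (zero_pow (M₀ := ℝ) two_ne_zero).symm

instance : Nonempty (CStarSeminorm B.Cc) := ⟨B.zeroSeminorm⟩

/-- The universal C⋆-seminorm `‖f‖_u = sup {p(f) : p a C⋆-seminorm on C_c(B)}`. -/
def uNorm (f : B.Cc) : ℝ := ⨆ p : CStarSeminorm B.Cc, p f

theorem le_uNorm (p : CStarSeminorm B.Cc) (f : B.Cc) : p f ≤ B.uNorm f :=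
  le_ciSup (B.bddAbove_seminorm f) p

theorem uNorm_nonneg (f : B.Cc) : 0 ≤ B.uNorm f :=
  (apply_nonneg (Classical.arbitrary (CStarSeminorm B.Cc)).toSeminorm f).trans (B.le_uNorm _ f)

/-- `‖·‖_u` as a C⋆-seminorm. -/
def uSeminorm : CStarSeminorm B.Cc where
  toFun := B.uNorm
  map_zero' := by
    refine le_antisymm (ciSup_le fun p => (map_zero p.toSeminorm).le) (B.uNorm_nonneg 0)
  add_le' x y := ciSup_le fun p => (map_add_le_add p.toSeminorm x y).trans
    (add_le_add (B.le_uNorm p x) (B.le_uNorm p y))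
  neg' x := by
    simp only [uNorm, map_neg_eq_map]
  smul' c x := by
    simp only [uNorm, map_smul_eq_mul]
    exact (Real.mul_iSup_of_nonneg (norm_nonneg c) _).symm
  mul_le' x y := ciSup_le fun p => (p.mul_le' x y).trans
    (mul_le_mul (B.le_uNorm p x) (B.le_uNorm p y) (apply_nonneg p.toSeminorm y) (B.uNorm_nonneg x))
  star' x := iSup_congr fun p => p.star' x
  star_mul_self' x := by
    refine le_antisymm (ciSup_le fun p => ?_) ?_
    · rw [show p (star x * x) = p x ^ 2 from p.star_mul_self' x]
      exact pow_le_pow_left₀ (apply_nonneg p.toSeminorm x) (B.le_uNorm p x) 2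
    · have h : B.uNorm x ≤ √(B.uNorm (star x * x)) := ciSup_le fun p =>
        Real.le_sqrt_of_sq_le (by
          rw [← show p (star x * x) = p x ^ 2 from p.star_mul_self' x]
          exact B.le_uNorm p _)
      exact (pow_le_pow_left₀ (B.uNorm_nonneg x) h 2).trans_eq (Real.sq_sqrt (B.uNorm_nonneg _))

/-- The full cross-sectional C⋆-algebra `C*(B)`. -/
abbrev FullCStar : Type (max u v) := B.uSeminorm.Completion

/-- The canonical map `κ : C_c(B) → C*(B)`. -/
def kappa : B.Cc →⋆ₙₐ[ℂ] B.FullCStar := B.uSeminorm.toCompletionHom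

/-! ### The Hilbert module `ℓ²(B)` -/

open scoped Classical in
/-- The `B_e`-valued inner product `⟨f₁, f₂⟩ = ∑_h f₁(h)* f₂(h)` on `C_c(B)`. -/
def ip (f₁ f₂ : B.Cc) : B.Fib 1 :=
  ∑ h ∈ DFinsupp.support f₁, B.mul (inv_mul_cancel h) (B.inv rfl (f₁ h)) (f₂ h)

theorem mul_apply_congr {g k k' : G} (e : k = k') (p : g * k = 1) (q : g * k' = 1) (a : B.Fib g)
    (f : B.Cc) : B.mul p a (f k) = B.mul q a (f k') := by
  subst e; rfl

theorem inv_apply_congr {k k' l : G} (e : k = k') (p : k⁻¹ = l) (q : k'⁻¹ = l) (f : B.Cc) :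
    B.inv p (f k) = B.inv q (f k') := by
  subst e; rfl

theorem ip_eq (f₁ f₂ : B.Cc) : B.ip f₁ f₂ = (star f₁ * f₂) 1 := by
  classical
  have e : (star f₁ * f₂) 1 = ∑ g ∈ DFinsupp.support f₁, (star (B.j g (f₁ g)) * f₂) 1 := by
    conv_lhs => rw [← B.sum_j f₁, star_sum, Finset.sum_mul]
    exact DFinsupp.finsetSum_apply _ _ _
  rw [e]
  refine Finset.sum_congr (by congr!) fun g _ => ?_
  rw [B.star_j rfl, B.j_mul_apply]
  exact B.mul_apply_congr (by simp) _ _ _ _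

theorem ip_add_right (x y z : B.Cc) : B.ip x (y + z) = B.ip x y + B.ip x z := by
  simp only [ip_eq, mul_add, Cc.add_apply]

theorem ip_add_left (x y z : B.Cc) : B.ip (x + y) z = B.ip x z + B.ip y z := by
  simp only [ip_eq, star_add, add_mul, Cc.add_apply]

theorem ip_zero_left (y : B.Cc) : B.ip 0 y = 0 := by
  simp only [ip_eq, star_zero, zero_mul, Cc.zero_apply]

theorem ip_zero_right (y : B.Cc) : B.ip y 0 = 0 := by
  simp only [ip_eq, mul_zero, Cc.zero_apply]

theorem ip_smul_right (c : ℂ) (x y : B.Cc) : B.ip x (c • y) = c • B.ip x y := by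
  rw [ip_eq, ip_eq, mul_smul_comm]
  exact DFinsupp.smul_apply c _ 1

theorem star_ip (x y : B.Cc) : star (B.ip x y) = B.ip y x := by
  have h : ∀ z : B.Cc, star (z 1) = (star z) 1 := fun z => by
    rw [B.star_apply, unit_star_def]
    exact B.inv_apply_congr inv_one.symm _ _ z
  rw [ip_eq, ip_eq, h, star_mul, star_star]

theorem ip_smul_left (c : ℂ) (x y : B.Cc) : B.ip (c • x) y = star c • B.ip x y := by
  rw [← B.star_ip, ip_smul_right, star_smul, B.star_ip]

theorem ip_mul_left (f x y : B.Cc) : B.ip (f * x) y = B.ip x (star f * y) := by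
  rw [ip_eq, ip_eq, star_mul, _root_.mul_assoc]

theorem ip_self_nonneg (x : B.Cc) : 0 ≤ B.ip x x :=
  Finset.sum_nonneg fun _ _ => B.inv_mul_self_nonneg _ _ _

theorem ip_jUnit_right (x y : B.Cc) (a : B.Fib 1) : B.ip x (y * B.jUnit a) = B.ip x y * a := by
  have h : ∀ z : B.Cc, (z * B.jUnit a) 1 = z 1 * a := fun z => by
    induction z using Cc.induction with
    | h0 => rw [zero_mul, Cc.zero_apply, zero_mul]
    | hadd f₁ f₂ h₁ h₂ => rw [add_mul, Cc.add_apply, Cc.add_apply, add_mul, h₁, h₂]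
    | hj g b =>
      change (B.j g b * B.j 1 a) 1 = _
      rw [B.j_mul_j (mul_one g)]
      by_cases hg : g = 1
      · subst hg
        rw [B.j_apply_same, B.j_apply_same]; rfl
      · rw [B.j_apply_ne hg, B.j_apply_ne hg, zero_mul]
  rw [ip_eq, ip_eq, ← _root_.mul_assoc, h]

theorem ip_jUnit_left (x y : B.Cc) (a : B.Fib 1) :
    B.ip (x * B.jUnit a) y = star a * B.ip x y := by
  rw [← B.star_ip, ip_jUnit_right, star_mul, B.star_ip]

theorem ip_j_ne {g h : G} (e : g ≠ h) (a : B.Fib g) (b : B.Fib h) :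
    B.ip (B.j g a) (B.j h b) = 0 := by
  rw [ip_eq, B.star_j rfl, B.j_mul_j rfl, B.j_apply_ne]
  exact fun h' => e (inv_mul_eq_one.1 h')

theorem ip_j_same {g : G} (a b : B.Fib g) :
    B.ip (B.j g a) (B.j g b) = B.mul (inv_mul_cancel g) (B.inv rfl a) b := by
  rw [ip_eq, B.star_j rfl, B.j_mul_j (inv_mul_cancel g), B.j_apply_same]

theorem ip_sum_sum {σ : G → G} (hσ : Function.Injective σ) (S : Finset G)
    (c : ∀ h, B.Fib (σ h)) :
    B.ip (∑ h ∈ S, B.j (σ h) (c h)) (∑ h ∈ S, B.j (σ h) (c h)) =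
      ∑ h ∈ S, B.mul (inv_mul_cancel (σ h)) (B.inv rfl (c h)) (c h) := by
  classical
  let φ : B.Cc →+ B.Cc →+ B.Fib 1 :=
    AddMonoidHom.mk' (fun x => AddMonoidHom.mk' (B.ip x) (B.ip_add_right x))
      fun x y => AddMonoidHom.ext fun z => B.ip_add_left x y z
  change φ _ _ = _
  rw [map_sum φ, AddMonoidHom.finsetSum_apply]
  refine Finset.sum_congr rfl fun h hh => ?_
  rw [map_sum, Finset.sum_eq_single h]
  · exact B.ip_j_same _ _
  · exact fun k _ hk => B.ip_j_ne (fun e => hk (hσ e).symm) _ _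
  · exact fun h' => absurd hh h'

theorem ip_j_mul_le {g : G} (a : B.Fib g) (x : B.Cc) :
    B.ip (B.j g a * x) (B.j g a * x) ≤ ((‖a‖ ^ 2 : ℝ) : ℂ) • B.ip x x := by
  classical
  have h1 : B.j g a * x = ∑ h ∈ DFinsupp.support x, B.j (g * h) (B.mul rfl a (x h)) := by
    conv_lhs => rw [← B.sum_j x, Finset.mul_sum]
    refine Finset.sum_congr (by congr!) fun h _ => B.j_mul_j rfl _ _
  rw [h1, B.ip_sum_sum (mul_right_injective g), ip, Finset.smul_sum]
  refine (Finset.sum_le_sum fun h _ => B.mul_conj_le rfl a (x h)).trans (le_of_eq ?_)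
  refine Finset.sum_congr (by congr!) fun _ _ => rfl

theorem norm_ip_sq_le (x y : B.Cc) : ‖B.ip x y‖ ^ 2 ≤ ‖B.ip x x‖ * ‖B.ip y y‖ := by
  have key : ∀ t : ℝ, ‖B.ip x x‖ < t → ‖B.ip x y‖ ^ 2 ≤ t * ‖B.ip y y‖ := fun t ht => by
    have t0 : 0 < t := (norm_nonneg _).trans_lt ht
    set a := B.ip x y with ha
    set b : B.Fib 1 := t⁻¹ • a with hb
    have hpos := B.ip_self_nonneg (x * B.jUnit b + (-1 : ℂ) • y)
    have ex : B.ip (x * B.jUnit b + (-1 : ℂ) • y) (x * B.jUnit b + (-1 : ℂ) • y) =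
        star b * B.ip x x * b - star b * a - star a * b + B.ip y y := by
      simp only [ip_add_left, ip_add_right, ip_smul_left, ip_smul_right, ip_jUnit_left,
        ip_jUnit_right, ha, B.star_ip]
      simp only [_root_.mul_assoc, add_mul, star_neg, star_one, neg_smul, one_smul, neg_mul]
      abel
    have h1 : star b * B.ip x x * b ≤ t⁻¹ • (star a * a) := by
      refine (CStarAlgebra.star_left_conjugate_le_norm_smul
        (IsSelfAdjoint.of_nonneg (B.ip_self_nonneg x))).trans ?_
      refine (smul_le_smul_of_nonneg_right ht.le (star_mul_self_nonneg b)).trans (le_of_eq ?_)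
      rw [hb, star_smul, smul_mul_smul_comm, smul_smul]
      congr 1
      simp
      field_simp
    have h2 : t⁻¹ • (star a * a) ≤ B.ip y y := by
      rw [ex] at hpos
      have e1 : star b * a = t⁻¹ • (star a * a) := by simp [hb, star_smul, smul_mul_assoc]
      have e2 : star a * b = t⁻¹ • (star a * a) := by simp [hb, mul_smul_comm]
      rw [e1, e2] at hpos
      have h3 := hpos.trans (add_le_add_left (sub_le_sub_right (sub_le_sub_right h1
        (t⁻¹ • (star a * a))) (t⁻¹ • (star a * a))) (B.ip y y))
      simpa using h3
    have h3 := CStarAlgebra.norm_le_norm_of_nonneg_of_le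
      (smul_nonneg (inv_nonneg.2 t0.le) (star_mul_self_nonneg a)) h2
    rw [norm_smul, CStarRing.norm_star_mul_self, _root_.norm_inv, Real.norm_of_nonneg t0.le,
      inv_mul_le_iff₀ t0] at h3
    rwa [sq]
  have hcont : Filter.Tendsto (fun t : ℝ => t * ‖B.ip y y‖)
      (nhdsWithin ‖B.ip x x‖ (Set.Ioi ‖B.ip x x‖)) (nhds (‖B.ip x x‖ * ‖B.ip y y‖)) :=
    ((continuous_id.mul continuous_const).tendsto _).mono_left nhdsWithin_le_nhds
  exact ge_of_tendsto hcont (Filter.eventually_of_mem self_mem_nhdsWithin fun t ht => key t ht)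

theorem norm_ip_le (x y : B.Cc) : ‖B.ip x y‖ ≤ √‖B.ip x x‖ * √‖B.ip y y‖ := by
  rw [← Real.sqrt_mul (norm_nonneg _)]
  exact Real.le_sqrt_of_sq_le (B.norm_ip_sq_le x y)

/-- `C_c(B)`, regarded as a pre-Hilbert `B_e`-module with the norm `‖f‖ = ‖⟨f, f⟩‖^{1/2}`. -/
def PreL2 : Type (max u v) := B.Cc

instance : AddCommGroup B.PreL2 := inferInstanceAs (AddCommGroup B.Cc)
instance : Module ℂ B.PreL2 := inferInstanceAs (Module ℂ B.Cc)
instance : Inner (B.Fib 1) B.PreL2 := ⟨B.ip⟩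

/-- The norm of the pre-Hilbert module `C_c(B)`. -/
def l2Seminorm : AddGroupSeminorm B.Cc where
  toFun x := √‖B.ip x x‖
  map_zero' := by rw [ip_zero_left, norm_zero, Real.sqrt_zero]
  add_le' x y := by
    refine Real.sqrt_le_iff.2 ⟨by positivity, ?_⟩
    rw [ip_add_left, ip_add_right, ip_add_right]
    have h1 := B.norm_ip_le x y
    have h2 := B.norm_ip_le y x
    have h3 := Real.sq_sqrt (norm_nonneg (B.ip x x))
    have h4 := Real.sq_sqrt (norm_nonneg (B.ip y y))
    have h5 := norm_add_le (B.ip x x + B.ip x y) (B.ip y x + B.ip y y)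
    have h6 := norm_add_le (B.ip x x) (B.ip x y)
    have h7 := norm_add_le (B.ip y x) (B.ip y y)
    nlinarith
  neg' x := by
    rw [← neg_one_smul ℂ x, ip_smul_left, ip_smul_right]
    simp

instance : SeminormedAddCommGroup B.PreL2 :=
  AddGroupSeminorm.toSeminormedAddCommGroup (E := B.PreL2) (show AddGroupSeminorm B.Cc from
    B.l2Seminorm)

theorem preL2_norm (x : B.PreL2) : ‖x‖ = √‖B.ip x x‖ := rfl

theorem preL2_inner (x y : B.PreL2) : inner (B.Fib 1) x y = B.ip x y := rfl

instance : NormedSpace ℂ B.PreL2 where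
  norm_smul_le c x := by
    rw [preL2_norm, preL2_norm]
    change √‖B.ip (c • (show B.Cc from x)) (c • (show B.Cc from x))‖ ≤ _
    rw [ip_smul_left, ip_smul_right, smul_smul, norm_smul, Real.sqrt_mul (norm_nonneg _),
      norm_mul, norm_star, Real.sqrt_mul_self (norm_nonneg _)]

/-- The Hilbert `B_e`-module `ℓ²(B)`, the completion of `C_c(B)`; the inner product
`inner (B.Fib 1)` is the continuous extension of that of `C_c(B)`. -/
abbrev L2 : Type (max u v) := UniformSpace.Completion B.PreL2

/-- The canonical map of `C_c(B)` into `ℓ²(B)`. -/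
def toL2 : B.Cc →ₗ[ℂ] B.L2 :=
  (UniformSpace.Completion.toComplL (𝕜 := ℂ) (E := B.PreL2)).toLinearMap.comp
    (show B.Cc →ₗ[ℂ] B.PreL2 from LinearMap.id)

namespace L2

open UniformSpace

variable {B}

theorem norm_inner_pre_le (x y : B.PreL2) : ‖inner (B.Fib 1) x y‖ ≤ ‖x‖ * ‖y‖ := B.norm_ip_le x y

/-- The inner product of `C_c(B)` as a biadditive map. -/
def innerHom : B.PreL2 →+ B.PreL2 →+ B.Fib 1 :=
  AddMonoidHom.mk' (fun x => AddMonoidHom.mk' (fun y => B.ip x y) (B.ip_add_right x))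
    fun x y => AddMonoidHom.ext fun z => B.ip_add_left x y z

theorem continuous_innerHom :
    Continuous fun p : B.PreL2 × B.PreL2 => innerHom (B := B) p.1 p.2 := by
  let ψ : B.PreL2 →ₗ⋆[ℂ] B.PreL2 →ₗ[ℂ] B.Fib 1 := LinearMap.mk₂'ₛₗ _ _ (fun x y => B.ip x y)
    B.ip_add_left B.ip_smul_left B.ip_add_right B.ip_smul_right
  exact ((ψ.mkContinuous₂ 1 fun x y => by
    rw [one_mul]; exact norm_inner_pre_le x y).continuous.comp continuous_fst).clm_apply
      continuous_snd

theorem continuous_inner_pre :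
    Continuous (Function.uncurry (inner (B.Fib 1) : B.PreL2 → B.PreL2 → B.Fib 1)) :=
  continuous_innerHom

theorem inner_coe (a b : B.PreL2) :
    inner (B.Fib 1) (a : B.L2) (b : B.L2) = B.ip a b :=
  (Completion.isDenseInducing_coe.prodMap Completion.isDenseInducing_coe).extend_eq
    continuous_inner_pre (a, b)

theorem continuous_inner :
    Continuous (Function.uncurry (inner (B.Fib 1) : B.L2 → B.L2 → B.Fib 1)) :=
  (Completion.isDenseInducing_toCompl B.PreL2).extend_Z_bilin
    (Completion.isDenseInducing_toCompl B.PreL2) (continuous_innerHom (B := B))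

theorem cont_inner {X : Type*} [TopologicalSpace X] {f g : X → B.L2} (hf : Continuous f)
    (hg : Continuous g) : Continuous fun x => inner (B.Fib 1) (f x) (g x) :=
  continuous_inner.comp (hf.prodMk hg)

theorem inner_add_right (x y z : B.L2) :
    inner (B.Fib 1) x (y + z) = inner (B.Fib 1) x y + inner (B.Fib 1) x z :=
  Completion.induction_on₃ x y z (isClosed_eq (cont_inner (by fun_prop) (by fun_prop))
    ((cont_inner (by fun_prop) (by fun_prop)).add (cont_inner (by fun_prop) (by fun_prop))))
    fun a b c => by
      rw [← Completion.coe_add, inner_coe, inner_coe, inner_coe]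
      exact B.ip_add_right a b c

theorem inner_smul_right (c : ℂ) (x y : B.L2) :
    inner (B.Fib 1) x (c • y) = c • inner (B.Fib 1) x y :=
  Completion.induction_on₂ x y (isClosed_eq (cont_inner continuous_fst
    (continuous_snd.const_smul c)) ((cont_inner continuous_fst continuous_snd).const_smul c))
    fun a b => by
      rw [← Completion.coe_smul, inner_coe, inner_coe]
      exact B.ip_smul_right c a b

theorem star_inner (x y : B.L2) : star (inner (B.Fib 1) x y) = inner (B.Fib 1) y x :=
  Completion.induction_on₂ x y (isClosed_eq
    (continuous_star.comp (cont_inner continuous_fst continuous_snd))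
    (cont_inner continuous_snd continuous_fst))
    fun a b => by
      rw [inner_coe, inner_coe]
      exact B.star_ip a b

theorem norm_inner_self (x : B.L2) : ‖inner (B.Fib 1) x x‖ = ‖x‖ ^ 2 :=
  Completion.induction_on x (isClosed_eq
    (cont_inner continuous_id continuous_id).norm (continuous_norm.pow 2))
    fun a => by
      rw [inner_coe, Completion.norm_coe, preL2_norm, Real.sq_sqrt (norm_nonneg _)]

theorem norm_inner_le (x y : B.L2) : ‖inner (B.Fib 1) x y‖ ≤ ‖x‖ * ‖y‖ :=
  Completion.induction_on₂ x y (isClosed_le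
    (cont_inner continuous_fst continuous_snd).norm (continuous_fst.norm.mul continuous_snd.norm))
    fun a b => by
      rw [inner_coe, Completion.norm_coe, Completion.norm_coe]
      exact norm_inner_pre_le a b

theorem inner_add_left (x y z : B.L2) :
    inner (B.Fib 1) (x + y) z = inner (B.Fib 1) x z + inner (B.Fib 1) y z := by
  rw [← star_inner, inner_add_right, star_add, star_inner, star_inner]

theorem inner_smul_left (c : ℂ) (x y : B.L2) :
    inner (B.Fib 1) (c • x) y = star c • inner (B.Fib 1) x y := by
  rw [← star_inner, inner_smul_right, star_smul, star_inner]

theorem inner_zero_left (y : B.L2) : inner (B.Fib 1) (0 : B.L2) y = 0 := by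
  have := inner_smul_left (0 : ℂ) (0 : B.L2) y
  rwa [zero_smul, star_zero, zero_smul] at this

theorem inner_zero_right (y : B.L2) : inner (B.Fib 1) y (0 : B.L2) = 0 := by
  rw [← star_inner, inner_zero_left, star_zero]

theorem ext_inner_left {y z : B.L2} (h : ∀ x : B.L2, inner (B.Fib 1) x y = inner (B.Fib 1) x z) :
    y = z := by
  have h1 : inner (B.Fib 1) (y - z) (y - z) = 0 := by
    have := h (y - z)
    rw [show y = (y - z) + z from (sub_add_cancel y z).symm, inner_add_right] at this
    simpa using this
  have h2 := norm_inner_self (y - z)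
  rw [h1, norm_zero] at h2
  exact sub_eq_zero.1 (norm_eq_zero.1 (pow_eq_zero_iff two_ne_zero |>.1 h2.symm))

end L2

/-! ### The C⋆-algebra of adjointable operators on `ℓ²(B)` -/

/-- The adjointable operators on `ℓ²(B)`, i.e. the operators `T` for which there is an operator `S`
with `⟨T x, y⟩ = ⟨x, S y⟩` for all `x, y`, with the operator norm. -/
def adjointable : Subalgebra ℂ (B.L2 →L[ℂ] B.L2) where
  carrier := {T | ∃ S : B.L2 →L[ℂ] B.L2,
    ∀ x y, inner (B.Fib 1) (T x) y = inner (B.Fib 1) x (S y)}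
  mul_mem' := by
    rintro T₁ T₂ ⟨S₁, h₁⟩ ⟨S₂, h₂⟩
    exact ⟨S₂ * S₁, fun x y => (h₁ (T₂ x) y).trans (h₂ x (S₁ y))⟩
  add_mem' := by
    rintro T₁ T₂ ⟨S₁, h₁⟩ ⟨S₂, h₂⟩
    refine ⟨S₁ + S₂, fun x y => ?_⟩
    rw [_root_.add_apply, _root_.add_apply, L2.inner_add_left,
      L2.inner_add_right, h₁, h₂]
  algebraMap_mem' c := by
    refine ⟨star c • 1, fun x y => ?_⟩
    rw [Algebra.algebraMap_eq_smul_one, _root_.smul_apply,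
      _root_.smul_apply, L2.inner_smul_left, L2.inner_smul_right]
    rfl

/-- The algebra `𝓛(ℓ²(B))` of adjointable operators. -/
def Adj : Type (max u v) := B.adjointable

instance : NormedRing B.Adj := inferInstanceAs (NormedRing B.adjointable)
instance : NormedAlgebra ℂ B.Adj := inferInstanceAs (NormedAlgebra ℂ B.adjointable)

namespace Adj

variable {B}

/-- The adjoint of an adjointable operator. -/
instance : Star B.Adj :=
  ⟨fun T => ⟨T.2.choose, T.1, fun x y => by
    rw [← L2.star_inner, ← T.2.choose_spec, L2.star_inner]⟩⟩

theorem inner_apply (T : B.Adj) (x y : B.L2) :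
    inner (B.Fib 1) (T.1 x) y = inner (B.Fib 1) x ((star T).1 y) :=
  T.2.choose_spec x y

theorem eq_star {S T : B.Adj}
    (h : ∀ x y, inner (B.Fib 1) (T.1 x) y = inner (B.Fib 1) x (S.1 y)) : star T = S :=
  Subtype.ext <| ContinuousLinearMap.ext fun y => L2.ext_inner_left fun x => by
    rw [← inner_apply, h]

instance : StarRing B.Adj where
  star_involutive T := eq_star fun x y => by
    rw [← L2.star_inner, ← inner_apply, L2.star_inner]
  star_mul S T := eq_star fun x y => by
    change inner (B.Fib 1) (S.1 (T.1 x)) y = inner (B.Fib 1) x ((star T).1 ((star S).1 y))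
    rw [inner_apply, inner_apply]
  star_add S T := eq_star fun x y => by
    change inner (B.Fib 1) (S.1 x + T.1 x) y = inner (B.Fib 1) x ((star S).1 y + (star T).1 y)
    rw [L2.inner_add_left, L2.inner_add_right, inner_apply, inner_apply]

instance : StarModule ℂ B.Adj where
  star_smul c T := eq_star fun x y => by
    change inner (B.Fib 1) (c • T.1 x) y = inner (B.Fib 1) x (star c • (star T).1 y)
    rw [L2.inner_smul_left, L2.inner_smul_right, inner_apply]

theorem norm_def (T : B.Adj) : ‖T‖ = ‖T.1‖ := rfl

instance : CStarRing B.Adj where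
  norm_mul_self_le T := by
    have h : ‖T.1‖ ≤ √‖star T * T‖ := ContinuousLinearMap.opNorm_le_bound _ (Real.sqrt_nonneg _)
      fun x => by
        rw [← Real.sqrt_sq (norm_nonneg x), ← Real.sqrt_mul (norm_nonneg _)]
        refine Real.le_sqrt_of_sq_le ?_
        rw [← L2.norm_inner_self, inner_apply]
        refine (L2.norm_inner_le _ _).trans ?_
        have := (star T * T).1.le_opNorm x
        rw [← norm_def] at this
        calc ‖x‖ * ‖(star T).1 (T.1 x)‖ ≤ ‖x‖ * (‖star T * T‖ * ‖x‖) :=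
              mul_le_mul_of_nonneg_left this (norm_nonneg x)
          _ = ‖star T * T‖ * ‖x‖ ^ 2 := by ring
    have h2 := mul_self_le_mul_self (norm_nonneg _) h
    rwa [Real.mul_self_sqrt (norm_nonneg _)] at h2

instance : CompleteSpace B.Adj := by
  refine Metric.complete_of_cauchySeq_tendsto fun u hu => ?_
  have hu' : CauchySeq fun n => (u n).1 := hu.map uniformContinuous_subtype_val
  have hs : CauchySeq fun n => (star (u n)).1 :=
    (hu.map star_isometry.uniformContinuous).map uniformContinuous_subtype_val
  obtain ⟨T, hT⟩ := cauchySeq_tendsto_of_complete hu'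
  obtain ⟨S, hS⟩ := cauchySeq_tendsto_of_complete hs
  have hTS : ∀ x y, inner (B.Fib 1) (T x) y = inner (B.Fib 1) x (S y) := fun x y => by
    have c1 : Continuous fun R : B.L2 →L[ℂ] B.L2 => inner (B.Fib 1) (R x) y :=
      L2.cont_inner (ContinuousLinearMap.apply ℂ B.L2 x).continuous continuous_const
    have c2 : Continuous fun R : B.L2 →L[ℂ] B.L2 => inner (B.Fib 1) x (R y) :=
      L2.cont_inner continuous_const (ContinuousLinearMap.apply ℂ B.L2 y).continuous
    refine tendsto_nhds_unique ((c1.tendsto T).comp hT) (((c2.tendsto S).comp hS).congr fun n => ?_)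
    exact (inner_apply (u n) x y).symm
  exact ⟨⟨T, S, hTS⟩, tendsto_subtype_rng.2 hT⟩

/-- `𝓛(ℓ²(B))` is a C⋆-algebra. -/
instance : CStarAlgebra B.Adj where

end Adj

/-! ### The regular representation and the reduced cross-sectional C⋆-algebra -/

theorem exists_bound (f : B.Cc) :
    ∃ C, ∀ x : B.Cc, B.l2Seminorm (f * x) ≤ C * B.l2Seminorm x := by
  induction f using Cc.induction with
  | h0 =>
    refine ⟨0, fun x => ?_⟩
    rw [zero_mul, zero_mul, map_zero]
  | hadd f₁ f₂ h₁ h₂ =>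
    obtain ⟨C₁, h₁⟩ := h₁
    obtain ⟨C₂, h₂⟩ := h₂
    refine ⟨C₁ + C₂, fun x => ?_⟩
    rw [add_mul, add_mul]
    exact (map_add_le_add B.l2Seminorm _ _).trans (add_le_add (h₁ x) (h₂ x))
  | hj g a =>
    refine ⟨‖a‖, fun x => ?_⟩
    change √‖B.ip (B.j g a * x) (B.j g a * x)‖ ≤ ‖a‖ * √‖B.ip x x‖
    refine Real.sqrt_le_iff.2 ⟨by positivity, ?_⟩
    rw [mul_pow, Real.sq_sqrt (norm_nonneg _)]
    refine (CStarAlgebra.norm_le_norm_of_nonneg_of_le (B.ip_self_nonneg _)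
      (B.ip_j_mul_le a x)).trans ?_
    rw [norm_smul, Complex.norm_real, norm_pow, norm_norm]

/-- Left convolution by `f ∈ C_c(B)` as a bounded operator on the pre-Hilbert module `C_c(B)`. -/
def preLeft (f : B.Cc) : B.PreL2 →L[ℂ] B.PreL2 :=
  LinearMap.mkContinuousOfExistsBound (show B.Cc →ₗ[ℂ] B.Cc from B.conv f) (B.exists_bound f)

/-- Left convolution by `f ∈ C_c(B)` as a bounded operator on `ℓ²(B)`. -/
def left (f : B.Cc) : B.L2 →L[ℂ] B.L2 := (B.preLeft f).completion

theorem left_toL2 (f x : B.Cc) : B.left f (B.toL2 x) = B.toL2 (f * x) :=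
  ContinuousLinearMap.completion_apply_coe _ _

theorem inner_toL2 (x y : B.Cc) : inner (B.Fib 1) (B.toL2 x) (B.toL2 y) = B.ip x y :=
  L2.inner_coe _ _

theorem inner_left (f : B.Cc) (x y : B.L2) :
    inner (B.Fib 1) (B.left f x) y = inner (B.Fib 1) x (B.left (star f) y) :=
  UniformSpace.Completion.induction_on₂ x y (isClosed_eq
    (L2.cont_inner ((B.left f).continuous.comp continuous_fst) continuous_snd)
    (L2.cont_inner continuous_fst ((B.left (star f)).continuous.comp continuous_snd)))
    fun (a b : B.Cc) => by
      have h : inner (B.Fib 1) (B.left f (B.toL2 a)) (B.toL2 b) =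
          inner (B.Fib 1) (B.toL2 a) (B.left (star f) (B.toL2 b)) := by
        rw [left_toL2, left_toL2, inner_toL2, inner_toL2, ip_mul_left]
      exact h

theorem left_ext {S T : B.L2 →L[ℂ] B.L2} (h : ∀ x : B.Cc, S (B.toL2 x) = T (B.toL2 x)) :
    S = T :=
  ContinuousLinearMap.ext fun x => UniformSpace.Completion.induction_on x
    (isClosed_eq S.continuous T.continuous) h

/-- Left convolution by `f ∈ C_c(B)` as an adjointable operator on `ℓ²(B)`. -/
def leftAdj (f : B.Cc) : B.Adj := ⟨B.left f, B.left (star f), B.inner_left f⟩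

theorem leftAdj_star (f : B.Cc) : B.leftAdj (star f) = star (B.leftAdj f) :=
  (Adj.eq_star (T := B.leftAdj f) (S := B.leftAdj (star f)) (B.inner_left f)).symm

/-- The representation `ι` of `C_c(B)` by adjointable operators on `ℓ²(B)`: `ι(f)` is the continuous
extension of the left convolution by `f`, so that `ι(f) = ∑_g λ_g(f(g))`; see `iota_eq_sum`. -/
def iota : B.Cc →⋆ₙₐ[ℂ] B.Adj where
  toFun := B.leftAdj
  map_smul' c f := Subtype.ext <| B.left_ext fun x => by
    change B.left (c • f) (B.toL2 x) = c • B.left f (B.toL2 x)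
    rw [left_toL2, left_toL2, smul_mul_assoc, map_smul]
  map_zero' := Subtype.ext <| B.left_ext fun x => by
    change B.left 0 (B.toL2 x) = 0
    rw [left_toL2, zero_mul, map_zero]
  map_add' f₁ f₂ := Subtype.ext <| B.left_ext fun x => by
    change B.left (f₁ + f₂) (B.toL2 x) = B.left f₁ (B.toL2 x) + B.left f₂ (B.toL2 x)
    rw [left_toL2, left_toL2, left_toL2, add_mul, map_add]
  map_mul' f₁ f₂ := Subtype.ext <| B.left_ext fun x => by
    change B.left (f₁ * f₂) (B.toL2 x) = B.left f₁ (B.left f₂ (B.toL2 x))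
    rw [left_toL2, left_toL2, left_toL2, _root_.mul_assoc]
  map_star' := B.leftAdj_star

/-- The (left) regular representation `λ_g : B_g → 𝓛(ℓ²(B))`. -/
def lam (g : G) (a : B.Fib g) : B.Adj := B.iota (B.j g a)

/-- `λ_g(a)` maps `f ∈ C_c(B)` to `(a ⊙ g) ∗ f`, whose value at `h` is `a f(g⁻¹ h)` by
`j_mul_apply`. -/
theorem lam_toL2 {g : G} (a : B.Fib g) (f : B.Cc) :
    (B.lam g a).1 (B.toL2 f) = B.toL2 (B.j g a * f) := B.left_toL2 _ _

open scoped Classical in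
theorem iota_eq_sum (f : B.Cc) : B.iota f = ∑ g ∈ DFinsupp.support f, B.lam g (f g) := by
  conv_lhs => rw [← B.sum_j f, map_sum]
  rfl

/-- The reduced cross-sectional C⋆-algebra `C_r*(B)`: the C⋆-subalgebra of `𝓛(ℓ²(B))` generated by
`ι(C_c(B))`, i.e. the norm closure of this ⋆-subalgebra. -/
def redSubalgebra : NonUnitalStarSubalgebra ℂ B.Adj :=
  (NonUnitalStarAlgHom.range B.iota).topologicalClosure

/-- `C_r*(B)` as a type. -/
def RedCStar : Type (max u v) := B.redSubalgebra

instance : NonUnitalCStarAlgebra B.RedCStar :=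
  NonUnitalStarSubalgebra.nonUnitalCStarAlgebra B.redSubalgebra
    (h_closed := NonUnitalStarSubalgebra.isClosed_topologicalClosure
      (NonUnitalStarAlgHom.range B.iota))

/-- The C⋆-seminorm `‖f‖_r = ‖ι(f)‖` on `C_c(B)`. -/
def redSeminorm : CStarSeminorm B.Cc where
  toFun f := ‖B.iota f‖
  map_zero' := by rw [map_zero, norm_zero]
  add_le' x y := by rw [map_add]; exact norm_add_le _ _
  neg' x := by rw [map_neg, norm_neg]
  smul' c x := by rw [map_smul, norm_smul]
  mul_le' x y := by rw [map_mul]; exact _root_.norm_mul_le _ _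
  star' x := by rw [map_star, norm_star]
  star_mul_self' x := by rw [map_mul, map_star, CStarRing.norm_star_mul_self, sq]

theorem norm_iota_le (f : B.Cc) : ‖B.iota f‖ ≤ B.uSeminorm f := B.le_uNorm B.redSeminorm f

/-- The continuous extension of `ι` to `C*(B)`, with values in `𝓛(ℓ²(B))`. -/
def fullRep : B.FullCStar →⋆ₙₐ[ℂ] B.Adj := B.uSeminorm.lift B.iota B.norm_iota_le

theorem fullRep_kappa (f : B.Cc) : B.fullRep (B.kappa f) = B.iota f :=
  B.uSeminorm.lift_toCompletionHom _ _ f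

theorem fullRep_mem (x : B.FullCStar) : B.fullRep x ∈ B.redSubalgebra := by
  have hc : Continuous B.fullRep :=
    AddMonoidHomClass.continuous_of_bound B.fullRep 1 fun x => by
      rw [one_mul]; exact NonUnitalStarAlgHom.norm_apply_le B.fullRep x
  refine B.uSeminorm.denseRange_toCompletionHom.induction_on
    (p := fun x => B.fullRep x ∈ B.redSubalgebra) x
    ((NonUnitalStarSubalgebra.isClosed_topologicalClosure
      (NonUnitalStarAlgHom.range B.iota)).preimage hc) fun f => ?_
  refine NonUnitalStarSubalgebra.le_topologicalClosure (NonUnitalStarAlgHom.range B.iota) ?_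
  exact (NonUnitalStarAlgHom.mem_range B.iota).2 ⟨f, (B.fullRep_kappa f).symm⟩

/-- The canonical ⋆-homomorphism `Λ : C*(B) → C_r*(B)`, determined by `Λ ∘ κ = ι`. -/
def Lambda : B.FullCStar →⋆ₙₐ[ℂ] B.RedCStar :=
  NonUnitalStarAlgHom.codRestrict B.fullRep B.redSubalgebra B.fullRep_mem

theorem Lambda_kappa (f : B.Cc) : (B.Lambda (B.kappa f)).1 = B.iota f := B.fullRep_kappa f

/-- The weak containment property: `Λ : C*(B) → C_r*(B)` is injective. -/
def HasWCP : Prop := Function.Injective B.Lambda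

/-! ### Positive definite bundle maps and the PD-approximation property -/

/-- A `B`-bundle map: a family of bounded linear maps `T_g : B_g → B_g`. -/
def BundleMap : Type (max u v) := ∀ g, B.Fib g →L[ℂ] B.Fib g

variable {B} in
/-- `T` is positive definite if `∑_{i,j} b_i T_{g_i⁻¹ g_j}(a_i* a_j) b_j*` is a positive element of
`B_e` for all `g_i ∈ G` and `a_i, b_i ∈ B_{g_i}`, `i = 1, …, n`. -/
def BundleMap.IsPosDef (T : B.BundleMap) : Prop :=
  ∀ (n : ℕ) (g : Fin n → G) (a b : ∀ i, B.Fib (g i)),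
    0 ≤ ∑ i, ∑ k, B.mul (mul_inv_cancel (g k))
      (B.mul (mul_inv_cancel_left (g i) (g k)) (b i)
        (T ((g i)⁻¹ * g k) (B.mul rfl (B.inv rfl (a i)) (a k))))
      (B.inv rfl (b k))

/-- The PD-approximation property: there is a net of finitely supported positive definite
`B`-bundle maps `T^i` with `sup_i ‖T^i_e‖ < ∞` which converges pointwise to the identity. -/
def HasPDApproximationProperty : Prop :=
  ∃ (I : Type w) (_ : Preorder I) (_ : Nonempty I) (_ : IsDirectedOrder I) (T : I → B.BundleMap),
    (∀ i, (T i).IsPosDef ∧ {g | T i g ≠ 0}.Finite) ∧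
    (∃ C : ℝ, ∀ i, ‖T i 1‖ ≤ C) ∧
    ∀ (g : G) (b : B.Fib g), Filter.Tendsto (fun i => ‖T i g b - b‖) Filter.atTop (nhds 0)

end FellBundle

end

/-! A bundle map `T` acts on sections fibrewise, and so gives a linear map from `C_c(B)` to `C*(B)`,
called `T.toFull`. Along the given net these maps converge pointwise to `κ`. It therefore suffices
to prove `‖T.toFull f‖ ≤ C ‖ι(f)‖` with a constant depending only on a bound for `‖T_e‖`: the limit
gives `‖κ(f)‖ ≤ C ‖ι(f)‖`. Then `Λ` is bounded below, hence injective with closed range, and its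
range is dense.

The uniform constant comes in two stages. Every coefficient satisfies `‖f(g)‖ ≤ ‖ι(f)‖`, so finite
support gives a bound `‖T.toFull f‖ ≤ D ‖ι(f)‖`, but with `D` depending on the support
(`exists_norm_toFull_le`). The Schwarz inequality `‖T.toFull f‖² ≤ C ‖T.toFull (f* f)‖`
(`norm_toFull_sq_le`), iterated along `f`, `f* f`, `(f* f)² `, and so on, then replaces `D` by `C`
(`le_mul_of_sq_le_of_le`).

The Schwarz inequality follows from complete positivity: the matrix with entries `T_{g_i⁻¹ g_k}(a_i*
a_k)` has the form `R* R` over `C*(B)` (`exists_eq_star_mul_self`). Two obstacles lie between this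
and positive definiteness. First, the definition only controls expressions with values in `B_e`.
This is enough, since the matrix is homogeneous for the grading by `G`: such matrices form a
C⋆-algebra, the negative part stays in it, and its columns are test vectors with values of degree
one (`exists_star_mul_self_of_graded`). Second, the definition requires `a_i` and `b_i` to lie in
the same fibre, whereas the test vector of column `k` supplies `b_i` in the fibre over `g_k⁻¹ g_i`.
Multiplying `a_i` on the left by `c*`, for `c` in the fibre over `g_k`, repairs this. With `c = v
a_k` chosen by functional calculus, the error is the same form for the family `(1 - w) a_i`, whose
`k`-th member is almost zero. Induction on the set of nonzero members deals with it
(`sum_star_mul_nonneg`). -/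

noncomputable section

/-! ### Preliminaries on C⋆-algebras and C⋆-seminorms -/

/-- Cauchy–Schwarz inequality for finite families in a C⋆-algebra. -/
theorem norm_sum_star_mul_sq_le {C ι : Type*} [NonUnitalCStarAlgebra C] [Fintype ι] (x y : ι → C) :
    ‖∑ i, star (x i) * y i‖ ^ 2 ≤ ‖∑ i, star (x i) * x i‖ * ‖∑ i, star (y i) * y i‖ := by
  let _ : PartialOrder C := CStarAlgebra.spectralOrder _
  have _ : StarOrderedRing C := CStarAlgebra.spectralOrderedRing _
  -- The inner product of `C` as a module over itself puts the adjoint on the right-hand factor, so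
  -- the families enter through their adjoints.
  let X : WithCStarModule C (ι → C) := (WithCStarModule.equiv C (ι → C)).symm fun i => star (x i)
  let Y : WithCStarModule C (ι → C) := (WithCStarModule.equiv C (ι → C)).symm fun i => star (y i)
  have h := CStarModule.norm_inner_le (A := C) (WithCStarModule C (ι → C)) (x := Y) (y := X)
  have h2 := pow_le_pow_left₀ (norm_nonneg _) h 2
  rw [mul_pow, WithCStarModule.pi_norm_sq, WithCStarModule.pi_norm_sq,
    WithCStarModule.pi_inner] at h2
  simpa [X, Y, WithCStarModule.inner_def, mul_comm] using h2

/-- For a positive element `s` of a C⋆-algebra, the map `1 - w` almost annihilates `s`, while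
`1 - (1 - w)² = v s v`. -/
theorem exists_approx_support {A : Type*} [NonUnitalCStarAlgebra A] [PartialOrder A]
    [StarOrderedRing A] {s : A} (hs : 0 ≤ s) {ε : ℝ} (hε : 0 < ε) :
    ∃ w v : A, star w = w ∧ star v = v ∧ ‖w‖ ≤ 1 ∧ w + w - w * w = v * s * v ∧
      ‖s - w * s - s * w + w * s * w‖ ≤ ε := by
  have hsa : IsSelfAdjoint s := .of_nonneg hs
  have hq : ∀ t ∈ quasispectrum ℝ s, 0 ≤ t := fun t ht => quasispectrum_nonneg_of_nonneg s hs t ht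
  have hpos : ∀ t : ℝ, 0 < t ^ 2 + ε ^ 2 := fun t => by positivity
  have hsq : ∀ t : ℝ, 0 < √(t ^ 2 + ε ^ 2) := fun t => Real.sqrt_pos.2 (hpos t)
  -- The functions are chosen so that `(1 - φ)² = ε² / (t² + ε²)` and `t ψ² = t² / (t² + ε²)` add up
  -- to `1` for `t ≥ 0`, while `t (1 - φ)² ≤ ε`. Both vanish at `0`, as the non-unital functional
  -- calculus requires.
  obtain ⟨φ, φ_eq⟩ : ∃ φ : ℝ → ℝ, ∀ t, φ t = 1 - ε / √(t ^ 2 + ε ^ 2) := ⟨_, fun _ => rfl⟩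
  obtain ⟨ψ, ψ_eq⟩ : ∃ ψ : ℝ → ℝ, ∀ t, ψ t = √(t / (t ^ 2 + ε ^ 2)) := ⟨_, fun _ => rfl⟩
  have hφ : Continuous φ := by
    rw [funext φ_eq]
    refine continuous_const.sub (continuous_const.div (by fun_prop) fun t => (hsq t).ne')
  have hψ : Continuous ψ := by
    rw [funext ψ_eq]
    exact (continuous_id.div (by fun_prop) fun t => (hpos t).ne').sqrt
  have hφ0 : φ 0 = 0 := by simp [φ_eq, Real.sqrt_sq hε.le, hε.ne']
  have hψ0 : ψ 0 = 0 := by simp [ψ_eq]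
  have hφ1 : ∀ t, ε / √(t ^ 2 + ε ^ 2) ≤ 1 := fun t => by
    rw [div_le_one (hsq t)]
    exact Real.le_sqrt_of_sq_le (by nlinarith [sq_nonneg t])
  have hsqq : ∀ t, (ε / √(t ^ 2 + ε ^ 2)) ^ 2 = ε ^ 2 / (t ^ 2 + ε ^ 2) := fun t => by
    rw [div_pow, Real.sq_sqrt (hpos t).le]
  refine ⟨cfcₙ φ s, cfcₙ ψ s, (cfcₙ_predicate φ s).star_eq, (cfcₙ_predicate ψ s).star_eq, ?_, ?_, ?_⟩
  · refine norm_cfcₙ_le fun t _ => ?_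
    rw [Real.norm_eq_abs, abs_le]
    have := hφ1 t
    have h0 : 0 ≤ ε / √(t ^ 2 + ε ^ 2) := by positivity
    constructor <;> simp only [φ_eq] <;> linarith
  · have hc := hφ.continuousOn (s := quasispectrum ℝ s)
    have hc' := hψ.continuousOn (s := quasispectrum ℝ s)
    have e : cfcₙ ψ s * s * cfcₙ ψ s = cfcₙ (fun t => ψ t * t * ψ t) s := by
      rw [cfcₙ_mul (fun t => ψ t * t) ψ s, cfcₙ_mul ψ (fun t => t) s, cfcₙ_id' ℝ s]
    rw [e, ← cfcₙ_add φ φ s, ← cfcₙ_mul φ φ s, ← cfcₙ_sub _ _ s]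
    refine cfcₙ_congr fun t ht => ?_
    have h1 : ψ t * t * ψ t = t * (ψ t) ^ 2 := by ring
    rw [h1]
    rw [ψ_eq, Real.sq_sqrt (div_nonneg (hq t ht) (hpos t).le)]
    have h2 : φ t + φ t - φ t * φ t = 1 - (ε / √(t ^ 2 + ε ^ 2)) ^ 2 := by simp only [φ_eq]; ring
    rw [h2, hsqq]
    have := (hpos t).ne'
    field_simp
    ring
  · have hc := hφ.continuousOn (s := quasispectrum ℝ s)
    have e : s - cfcₙ φ s * s - s * cfcₙ φ s + cfcₙ φ s * s * cfcₙ φ s =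
        cfcₙ (fun t => t - φ t * t - t * φ t + φ t * t * φ t) s := by
      rw [cfcₙ_add (fun t => t - φ t * t - t * φ t) (fun t => φ t * t * φ t) s,
        cfcₙ_sub (fun t => t - φ t * t) (fun t => t * φ t) s,
        cfcₙ_sub (fun t => t) (fun t => φ t * t) s,
        cfcₙ_mul (fun t => φ t * t) φ s, cfcₙ_mul φ (fun t => t) s,
        cfcₙ_mul (fun t => t) φ s, cfcₙ_id' ℝ s]
    rw [e]
    refine norm_cfcₙ_le fun t ht => ?_
    have h1 : t - φ t * t - t * φ t + φ t * t * φ t = t * (ε / √(t ^ 2 + ε ^ 2)) ^ 2 := by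
      simp only [φ_eq]; ring
    have h0 := hq t ht
    rw [h1, hsqq, Real.norm_of_nonneg (by positivity), ← mul_div_assoc, div_le_iff₀ (hpos t)]
    nlinarith [sq_nonneg (t - ε), mul_pos hε hε, mul_nonneg hε.le h0]

/-- If `N(f)² ≤ C N(f* f)` and `N` is dominated by a multiple of a C⋆-seminorm `r`, then
`N ≤ C r`. -/
theorem le_mul_of_sq_le_of_le {R : Type*} [NonUnitalRing R] [StarRing R] {N r : R → ℝ} {C D : ℝ}
    (hr : ∀ f, 0 ≤ r f) (hC : 0 < C)
    (h1 : ∀ f, N f ^ 2 ≤ C * N (star f * f)) (h2 : ∀ f, N f ≤ D * r f)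
    (h3 : ∀ f, r (star f * f) = r f ^ 2) (f : R) : N f ≤ C * r f := by
  -- The induction step applies the estimate for `m` to `star f * f`, using `N f ^ 2 ≤ C * N (star f
  -- * f)` on the left and the C⋆-identity for `r` on the right. The constant `D` is never raised to
  -- a power.
  have key : ∀ (m : ℕ) (f : R), C * N f ^ 2 ^ m ≤ D * (C * r f) ^ 2 ^ m := by
    intro m
    induction m with
    | zero =>
      intro f
      simp only [pow_zero, pow_one]
      nlinarith [h2 f]
    | succ m ih =>
      intro f
      have h := ih (star f * f)
      have h' : (N f ^ 2) ^ 2 ^ m ≤ (C * N (star f * f)) ^ 2 ^ m :=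
        pow_le_pow_left₀ (by positivity) (h1 f) _
      have e : D * (C * r f) ^ 2 ^ (m + 1) = C ^ 2 ^ m * (D * (C * r (star f * f)) ^ 2 ^ m) := by
        rw [h3, pow_succ' 2 m, pow_mul, mul_pow C (r f) 2, mul_pow, mul_pow, pow_two C, mul_pow]
        ring
      rw [e, pow_succ' 2 m, pow_mul]
      calc C * (N f ^ 2) ^ 2 ^ m ≤ C * (C * N (star f * f)) ^ 2 ^ m := by gcongr
        _ = C ^ 2 ^ m * (C * N (star f * f) ^ 2 ^ m) := by rw [mul_pow]; ring
        _ ≤ _ := by gcongr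
  by_contra! hlt
  have hNpos : 0 < N f := (mul_nonneg hC.le (hr f)).trans_lt hlt
  have hrpos : 0 < r f := by
    refine (hr f).lt_of_ne fun h => ?_
    have := h2 f
    rw [← h, mul_zero] at this
    linarith
  -- If the claim failed, this ratio would exceed `1`, although its powers `q ^ 2 ^ m` are bounded
  -- by `D / C`.
  set q := N f / (C * r f) with hq
  have hq1 : 1 < q := (one_lt_div (by positivity)).2 hlt
  have hb : ∀ m : ℕ, q ^ 2 ^ m ≤ D / C := fun m => by
    rw [hq, div_pow, div_le_div_iff₀ (by positivity) hC]
    linarith [key m f]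
  obtain ⟨m, hm⟩ := pow_unbounded_of_one_lt (D / C) hq1
  have := pow_le_pow_right₀ hq1.le (Nat.lt_two_pow_self (n := m)).le
  linarith [hb m]

/-- A selfadjoint element `y` of a C⋆-algebra is of the form `r* r` if its negative part `z`, of which
the equation `y z = -z²` is retained, vanishes. -/
theorem exists_star_mul_self_of_forall {A : Type*} [NonUnitalCStarAlgebra A] {y : A}
    (hy : star y = y)
    (h : ∀ r z : A, star z = z → z = star r * r → y * z = -(z * z) → r * z = 0) :
    ∃ r, y = star r * r := by
  let _ : PartialOrder A := CStarAlgebra.spectralOrder _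
  have _ : StarOrderedRing A := CStarAlgebra.spectralOrderedRing _
  have hy' : y = y⁺ - y⁻ := (CFC.posPart_sub_negPart y hy).symm
  have hz : 0 ≤ y⁻ := CFC.negPart_nonneg y
  obtain ⟨r, hr⟩ := CStarAlgebra.nonneg_iff_eq_star_mul_self.1 hz
  have hyz : y * y⁻ = -(y⁻ * y⁻) := by
    nth_rw 1 [hy']
    rw [sub_mul, CFC.posPart_mul_negPart, zero_sub]
  have hzsa : star y⁻ = y⁻ := (IsSelfAdjoint.of_nonneg hz).star_eq
  have h0 := h r _ hzsa hr hyz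
  -- With `z = y⁻ = r* r`, the relation `r z = 0` gives `z² = r* (r z) = 0`.
  have h1 : star y⁻ * y⁻ = 0 := by
    rw [hzsa]
    nth_rw 1 [hr]
    rw [_root_.mul_assoc, h0, mul_zero]
  rw [CStarRing.star_mul_self_eq_zero_iff _ |>.1 h1, sub_zero] at hy'
  exact CStarAlgebra.nonneg_iff_eq_star_mul_self.1 (hy' ▸ CFC.posPart_nonneg y)

/-! ### Positivity of matrices over a graded C⋆-algebra -/

section GradedMatrix

variable {G C ι : Type*} [Group G] [NonUnitalCStarAlgebra C] [Fintype ι]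

/-- The matrices whose entry at `(i, k)` is homogeneous of degree `g_i⁻¹ g_k`, for a grading of a
C⋆-algebra by closed subspaces `V_g`. -/
def gradedMatrix (V : G → Submodule ℂ C) (hmul : ∀ {g h x y}, x ∈ V g → y ∈ V h → x * y ∈ V (g * h))
    (hstar : ∀ {g x}, x ∈ V g → star x ∈ V g⁻¹) (g : ι → G) :
    NonUnitalStarSubalgebra ℂ (CStarMatrix ι ι C) where
  carrier := {M | ∀ i k, M i k ∈ V ((g i)⁻¹ * g k)}
  add_mem' hM hN i k := (V _).add_mem (hM i k) (hN i k)
  zero_mem' _ _ := (V _).zero_mem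
  smul_mem' c _ hM i k := (V _).smul_mem c (hM i k)
  mul_mem' {M N} hM hN i k := by
    rw [CStarMatrix.mul_apply]
    refine (V _).sum_mem fun l _ => ?_
    have := hmul (hM i l) (hN l k)
    rwa [mul_assoc, mul_inv_cancel_left] at this
  star_mem' {M} hM i k := by
    have := hstar (hM k i)
    rwa [mul_inv_rev, inv_inv] at this

theorem isClosed_gradedMatrix (V : G → Submodule ℂ C)
    (hmul : ∀ {g h x y}, x ∈ V g → y ∈ V h → x * y ∈ V (g * h))
    (hstar : ∀ {g x}, x ∈ V g → star x ∈ V g⁻¹) (hV : ∀ g, IsClosed (V g : Set C)) (g : ι → G) :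
    IsClosed (gradedMatrix V hmul hstar g : Set (CStarMatrix ι ι C)) := by
  have : (gradedMatrix V hmul hstar g : Set (CStarMatrix ι ι C)) =
      ⋂ i, ⋂ k, {M | M i k ∈ V ((g i)⁻¹ * g k)} := by
    ext M; simp only [Set.mem_iInter]; rfl
  rw [this]
  refine isClosed_iInter fun i => isClosed_iInter fun k => (hV _).preimage ?_
  exact (continuous_apply k).comp (continuous_apply (A := fun _ => ι → C) i)

variable [PartialOrder C] [StarOrderedRing C]

theorem eq_zero_of_sum_star_mul_self_nonpos {x : ι → C} (h : ∑ i, star (x i) * x i ≤ 0) (i : ι) :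
    x i = 0 := by
  have h1 := Finset.single_le_sum (f := fun i => star (x i) * x i)
    (fun i _ => star_mul_self_nonneg (x i)) (Finset.mem_univ i)
  exact CStarRing.star_mul_self_eq_zero_iff _ |>.1 (le_antisymm (h1.trans h) (star_mul_self_nonneg _))

/-- Homogeneous matrices form a C⋆-algebra, so the negative part `z = r* r` of `Y` is homogeneous
too, and its columns are admissible test vectors. On the `k`-th column the quadratic form of `Y`
takes the value `-((r z)* (r z))_{kk}`, so nonnegativity forces that column of `r z` to vanish. The
set `s` restricts the test to columns where `Y` may be nonzero, which is what permits induction on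
the support later. -/
theorem exists_star_mul_self_of_isSelfAdjoint (V : G → Submodule ℂ C)
    (hmul : ∀ {g h x y}, x ∈ V g → y ∈ V h → x * y ∈ V (g * h))
    (hstar : ∀ {g x}, x ∈ V g → star x ∈ V g⁻¹) (hV : ∀ g, IsClosed (V g : Set C)) (g : ι → G)
    (s : Finset ι) (Y : CStarMatrix ι ι C) (hY : ∀ i k, Y i k ∈ V ((g i)⁻¹ * g k))
    (hs : ∀ i k, i ∉ s → Y i k = 0) (hsa : star Y = Y)
    (hpos : ∀ k ∈ s, ∀ x : ι → C, (∀ i, x i ∈ V ((g i)⁻¹ * g k)) →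
      0 ≤ ∑ i, ∑ l, star (x i) * Y i l * x l) :
    ∃ R : CStarMatrix ι ι C, Y = star R * R := by
  let S := gradedMatrix V hmul hstar g
  let _ : NonUnitalCStarAlgebra S := NonUnitalStarSubalgebra.nonUnitalCStarAlgebra S
    (h_closed := isClosed_gradedMatrix V hmul hstar hV g)
  have key : ∃ R : S, (⟨Y, hY⟩ : S) = star R * R := by
    refine exists_star_mul_self_of_forall (Subtype.ext hsa) ?_
    rintro ⟨r, hr⟩ ⟨z, hz⟩ hzsa hzr hyz
    replace hzsa : star z = z := congrArg Subtype.val hzsa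
    replace hzr : z = star r * r := congrArg Subtype.val hzr
    replace hyz : Y * z = -(z * z) := congrArg Subtype.val hyz
    refine Subtype.ext (CStarMatrix.ext fun i k => ?_)
    change (r * z) i k = 0
    by_cases hk : k ∈ s
    · have h1 := hpos k hk (fun i => z i k) fun i => hz i k
      have h2 : ∑ i, ∑ l, star (z i k) * Y i l * z l k = -∑ i, star ((r * z) i k) * (r * z) i k := by
        have e1 : ∑ i, ∑ l, star (z i k) * Y i l * z l k = (star z * (Y * z)) k k := by
          simp only [CStarMatrix.mul_apply, CStarMatrix.star_apply, Finset.mul_sum, mul_assoc]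
        have e2 : star z * (Y * z) = -(star (r * z) * (r * z)) := by
          rw [hyz, star_mul, mul_neg]
          conv_rhs => rw [mul_assoc, ← mul_assoc (star r), ← hzr]
        rw [e1, e2, CStarMatrix.neg_apply, CStarMatrix.mul_apply]
        simp only [CStarMatrix.star_apply]
      rw [h2] at h1
      exact eq_zero_of_sum_star_mul_self_nonpos (x := fun i => (r * z) i k) (neg_nonneg.1 h1) i
    -- Outside `s` no test is available, but row `k` of `Y` is zero, and `z² = -Y z` then kills
    -- column `k` of `z` itself.
    · have h1 : (star z * z) k k = 0 := by
        rw [hzsa, ← neg_neg (z * z), ← hyz, CStarMatrix.neg_apply, CStarMatrix.mul_apply]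
        simp [hs k _ hk]
      rw [CStarMatrix.mul_apply] at h1 ⊢
      simp only [CStarMatrix.star_apply] at h1
      have h2 := eq_zero_of_sum_star_mul_self_nonpos (x := fun i => z i k) h1.le
      simp [h2]
  obtain ⟨R, hR⟩ := key
  exact ⟨R.1, congrArg Subtype.val hR⟩

/-- Positivity criterion for matrices over a graded C⋆-algebra: it suffices to test with vectors for
which the result is homogeneous of degree one. -/
theorem exists_star_mul_self_of_graded (V : G → Submodule ℂ C)
    (hmul : ∀ {g h x y}, x ∈ V g → y ∈ V h → x * y ∈ V (g * h))
    (hstar : ∀ {g x}, x ∈ V g → star x ∈ V g⁻¹) (hV : ∀ g, IsClosed (V g : Set C)) (g : ι → G)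
    (s : Finset ι) (Y : CStarMatrix ι ι C) (hY : ∀ i k, Y i k ∈ V ((g i)⁻¹ * g k))
    (hs : ∀ i k, i ∉ s → Y i k = 0) (hs' : ∀ i k, k ∉ s → Y i k = 0)
    (hpos : ∀ k ∈ s, ∀ x : ι → C, (∀ i, x i ∈ V ((g i)⁻¹ * g k)) →
      0 ≤ ∑ i, ∑ l, star (x i) * Y i l * x l) :
    ∃ R : CStarMatrix ι ι C, Y = star R * R := by
  refine exists_star_mul_self_of_isSelfAdjoint V hmul hstar hV g s Y hY hs ?_ hpos
  have hYs : ∀ i k, star Y i k ∈ V ((g i)⁻¹ * g k) := (gradedMatrix V hmul hstar g).star_mem' hY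
  -- Self-adjointness is itself a consequence of positivity. For imaginary `c` the matrix `c (Y -
  -- Y*)` is self-adjoint, and its form vanishes on test vectors because the form of `Y` has
  -- self-adjoint values there. So it is positive for both `c = i` and `c = -i`, which forces `Y =
  -- Y*`.
  have key : ∀ c : ℂ, star c = -c → ∃ R : CStarMatrix ι ι C, c • (Y - star Y) = star R * R := by
    intro c hc
    refine exists_star_mul_self_of_isSelfAdjoint V hmul hstar hV g s _
      (fun i k => (V _).smul_mem c ((V _).sub_mem (hY i k) (hYs i k))) ?_ ?_ ?_
    · intro i k hi
      rw [CStarMatrix.smul_apply, CStarMatrix.sub_apply, CStarMatrix.star_apply, hs i k hi,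
        hs' k i hi, star_zero, sub_zero, smul_zero]
    · rw [star_smul, star_sub, star_star, hc, neg_smul, ← smul_neg, neg_sub]
    · intro k hk x hx
      have h1 := hpos k hk x hx
      have h2 : ∑ i, ∑ l, star (x i) * (c • (Y - star Y)) i l * x l =
          c • (∑ i, ∑ l, star (x i) * Y i l * x l - star (∑ i, ∑ l, star (x i) * Y i l * x l)) := by
        rw [star_sum]
        simp only [star_sum, star_mul, star_star]
        rw [Finset.sum_comm (f := fun i l => star (x l) * (star (Y i l) * x i)),
          ← Finset.sum_sub_distrib, Finset.smul_sum]
        refine Finset.sum_congr rfl fun i _ => ?_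
        rw [← Finset.sum_sub_distrib, Finset.smul_sum]
        refine Finset.sum_congr rfl fun l _ => ?_
        rw [CStarMatrix.smul_apply, CStarMatrix.sub_apply, CStarMatrix.star_apply, mul_smul_comm,
          smul_mul_assoc, mul_sub, sub_mul, ← mul_assoc]
      rw [h2, (IsSelfAdjoint.of_nonneg h1).star_eq, sub_self, smul_zero]
  obtain ⟨R, hR⟩ := key Complex.I (by simp)
  obtain ⟨R', hR'⟩ := key (-Complex.I) (by simp)
  have h1 : 0 ≤ Complex.I • (Y - star Y) := hR ▸ star_mul_self_nonneg R
  have h2 : 0 ≤ -(Complex.I • (Y - star Y)) := by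
    rw [← neg_smul]; exact hR' ▸ star_mul_self_nonneg R'
  have h3 := le_antisymm (neg_nonneg.1 h2) h1
  have h4 := (smul_eq_zero.1 h3).resolve_left Complex.I_ne_zero
  exact (sub_eq_zero.1 h4).symm

end GradedMatrix

namespace FellBundle

variable {G : Type u} [Group G] (B : FellBundle.{u, v} G)

/-! ### The fibres in the full cross-sectional C⋆-algebra -/

instance : PartialOrder B.FullCStar := CStarAlgebra.spectralOrder _

instance : StarOrderedRing B.FullCStar := CStarAlgebra.spectralOrderedRing _

/-- The canonical map of the fibre `B_g` into `C*(B)`. -/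
def fib (g : G) : B.Fib g →ₗ[ℂ] B.FullCStar where
  toFun a := B.kappa (B.j g a)
  map_add' a b := by rw [map_add, map_add]
  map_smul' c a := by rw [map_smul, map_smul]; rfl

theorem fib_def {g : G} (a : B.Fib g) : B.fib g a = B.kappa (B.j g a) := rfl

theorem fib_mul {g h k : G} (p : g * h = k) (a : B.Fib g) (b : B.Fib h) :
    B.fib k (B.mul p a b) = B.fib g a * B.fib h b := by
  rw [fib_def, ← B.j_mul_j p, map_mul]; rfl

theorem fib_inv {g k : G} (p : g⁻¹ = k) (a : B.Fib g) :
    B.fib k (B.inv p a) = star (B.fib g a) := by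
  rw [fib_def, ← B.star_j p, map_star]; rfl

theorem norm_mul_inv_self {g k : G} (p : g⁻¹ = k) (q : g * k = 1) (a : B.Fib g) :
    ‖B.mul q a (B.inv p a)‖ = ‖a‖ ^ 2 := by
  have hk : k⁻¹ = g := by rw [← p, _root_.inv_inv]
  have := B.norm_inv_mul_self hk q (B.inv p a)
  rwa [B.inv_inv, B.norm_inv] at this

theorem ip_apply_le (f : B.Cc) (g : G) :
    B.mul (inv_mul_cancel g) (B.inv rfl (f g)) (f g) ≤ B.ip f f := by
  classical
  by_cases hg : f g = 0
  · rw [hg, map_zero]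
    exact B.ip_self_nonneg f
  · exact Finset.single_le_sum
      (f := fun h => B.mul (inv_mul_cancel h) (B.inv rfl (f h)) (f h))
      (fun h _ => B.inv_mul_self_nonneg _ _ _) (DFinsupp.mem_support_iff.2 hg)

theorem norm_apply_le_l2Seminorm (f : B.Cc) (g : G) : ‖f g‖ ≤ B.l2Seminorm f := by
  refine Real.le_sqrt_of_sq_le ?_
  rw [← B.norm_inv_mul_self rfl (inv_mul_cancel g)]
  exact CStarAlgebra.norm_le_norm_of_nonneg_of_le (B.inv_mul_self_nonneg _ _ _) (B.ip_apply_le f g)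

theorem mul_j_one_apply (f : B.Cc) (e : B.Fib 1) (g : G) :
    (f * B.j 1 e) g = B.mul (mul_one g) (f g) e := by
  induction f using Cc.induction with
  | h0 => rw [zero_mul, Cc.zero_apply, map_zero, LinearMap.zero_apply]
  | hadd f₁ f₂ h₁ h₂ => rw [add_mul, Cc.add_apply, h₁, h₂, Cc.add_apply, map_add,
      LinearMap.add_apply]
  | hj h b =>
    rw [B.j_mul_j (mul_one h)]
    by_cases hg : h = g
    · subst hg
      rw [B.j_apply_same, B.j_apply_same]
    · rw [B.j_apply_ne hg, B.j_apply_ne hg, map_zero, LinearMap.zero_apply]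

theorem norm_toL2 (f : B.Cc) : ‖B.toL2 f‖ = B.l2Seminorm f :=
  UniformSpace.Completion.norm_coe (E := B.PreL2) f

theorem l2Seminorm_mul_le (f x : B.Cc) : B.l2Seminorm (f * x) ≤ ‖B.iota f‖ * B.l2Seminorm x := by
  rw [← B.norm_toL2, ← B.norm_toL2, ← B.left_toL2]
  exact (B.left f).le_opNorm _

theorem l2Seminorm_j {g : G} (a : B.Fib g) : B.l2Seminorm (B.j g a) = ‖a‖ := by
  change √‖B.ip _ _‖ = _
  rw [ip_j_same, B.norm_inv_mul_self, Real.sqrt_sq (norm_nonneg a)]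

/-- Since `B_e` need not have a unit, `ι(f)` is tested on the section with value `q = a* a` at `1`,
where `a = f g`. The coefficient at `g` of the result is `a q`, so `‖a q‖ ≤ ‖ι(f)‖ ‖q‖`. Combined
with `q² = a* (a q)` and `‖q‖ = ‖a‖²` this gives the bound. -/
theorem norm_apply_le_norm_iota (f : B.Cc) (g : G) : ‖f g‖ ≤ ‖B.iota f‖ := by
  set a := f g with ha
  set q : B.Fib 1 := B.mul (inv_mul_cancel g) (B.inv rfl a) a with hq
  have hqn : ‖q‖ = ‖a‖ ^ 2 := B.norm_inv_mul_self _ _ a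
  have hqs : star q = q := (IsSelfAdjoint.of_nonneg (B.inv_mul_self_nonneg _ _ a)).star_eq
  have h1 : ‖B.mul (mul_one g) a q‖ ≤ ‖B.iota f‖ * ‖q‖ := by
    rw [ha, ← B.mul_j_one_apply]
    refine (B.norm_apply_le_l2Seminorm _ g).trans ((B.l2Seminorm_mul_le f _).trans_eq ?_)
    rw [B.l2Seminorm_j]
  have h2 : q * q = B.mul (inv_mul_cancel g) (B.inv rfl a) (B.mul (mul_one g) a q) :=
    B.mul_assoc _ _ _ _ _ _ _
  have h3 : ‖q‖ * ‖q‖ ≤ ‖a‖ * (‖B.iota f‖ * ‖q‖) := by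
    rw [← CStarRing.norm_star_mul_self, hqs, h2]
    refine (B.norm_mul_le _ _ _).trans ?_
    rw [B.norm_inv]
    gcongr
  rw [hqn] at h3
  by_contra! hlt
  have ha0 : 0 < ‖a‖ := (norm_nonneg _).trans_lt hlt
  have : ‖a‖ * (‖B.iota f‖ * ‖a‖ ^ 2) < ‖a‖ * (‖a‖ * ‖a‖ ^ 2) := by gcongr
  nlinarith

theorem norm_kappa (f : B.Cc) : ‖B.kappa f‖ = B.uSeminorm f := B.uSeminorm.norm_toCompletionHom f

/-- Every C⋆-seminorm is at most the fibre norm, and the reduced one already attains it. Hence the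
fibres sit in `C*(B)` as closed subspaces and supply the grading for the matrix criterion. -/
theorem norm_fib {g : G} (a : B.Fib g) : ‖B.fib g a‖ = ‖a‖ := by
  rw [fib_def, norm_kappa]
  refine le_antisymm (B.seminorm_j_le _ a) ?_
  have := (B.norm_apply_le_norm_iota (B.j g a) g).trans (B.norm_iota_le _)
  rwa [B.j_apply_same] at this

theorem isClosed_range_fib (g : G) : IsClosed (LinearMap.range (B.fib g) : Set B.FullCStar) := by
  have : Isometry (B.fib g) := AddMonoidHomClass.isometry_of_norm _ fun a => B.norm_fib a
  exact this.isClosedEmbedding.isClosed_range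

theorem mul_mem_range_fib {g h : G} {x y : B.FullCStar} (hx : x ∈ LinearMap.range (B.fib g))
    (hy : y ∈ LinearMap.range (B.fib h)) : x * y ∈ LinearMap.range (B.fib (g * h)) := by
  obtain ⟨a, rfl⟩ := hx
  obtain ⟨b, rfl⟩ := hy
  exact ⟨_, B.fib_mul rfl a b⟩

theorem star_mem_range_fib {g : G} {x : B.FullCStar} (hx : x ∈ LinearMap.range (B.fib g)) :
    star x ∈ LinearMap.range (B.fib g⁻¹) := by
  obtain ⟨a, rfl⟩ := hx
  exact ⟨_, B.fib_inv rfl a⟩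

/-- The map of the unit fibre into `C*(B)` preserves positivity. -/
theorem fib_one_nonneg {b : B.Fib 1} (hb : 0 ≤ b) : 0 ≤ B.fib 1 b := by
  obtain ⟨c, rfl⟩ := CStarAlgebra.nonneg_iff_eq_star_mul_self.1 hb
  rw [unit_mul_def, fib_mul, unit_star_def, fib_inv]
  exact star_mul_self_nonneg _

/-- An approximate unit of `B_e` acts as an approximate left unit on every fibre. -/
theorem tendsto_mul_approximateUnit {g : G} (a : B.Fib g) :
    Filter.Tendsto (fun e : B.Fib 1 => B.mul (one_mul g) e a)
      (CStarAlgebra.approximateUnit (B.Fib 1)) (nhds a) := by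
  set l := CStarAlgebra.approximateUnit (B.Fib 1)
  have hl := CStarAlgebra.increasingApproximateUnit (B.Fib 1)
  rw [tendsto_iff_norm_sub_tendsto_zero]
  set s : B.Fib 1 := B.mul (mul_inv_cancel g) a (B.inv rfl a) with hs
  have h1 : Filter.Tendsto (fun e : B.Fib 1 => √(2 * ‖e * s - s‖)) l (nhds 0) := by
    have h := (tendsto_iff_norm_sub_tendsto_zero.1 (hl.tendsto_mul_right s)).const_mul 2
    simpa using h.sqrt
  refine squeeze_zero' (Filter.Eventually.of_forall fun _ => norm_nonneg _) ?_ h1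
  filter_upwards [hl.eventually_norm, hl.eventually_star_eq] with e he hes
  refine Real.le_sqrt_of_sq_le ?_
  rw [← B.norm_mul_inv_self rfl (mul_inv_cancel g), ← B.norm_fib, fib_mul, fib_inv, map_sub, fib_mul]
  -- With `s = a a*`, this is `(e a - a)(e a - a)* = (e s - s)(e - 1)`, which reduces convergence on
  -- `B_g` to convergence on the C⋆-algebra `B_e`.
  have e1 : (B.fib 1 e * B.fib g a - B.fib g a) * star (B.fib 1 e * B.fib g a - B.fib g a) =
      B.fib 1 ((e * s - s) * e - (e * s - s)) := by
    rw [map_sub, unit_mul_def _ (e * s - s), fib_mul, map_sub, unit_mul_def, fib_mul, hs, fib_mul,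
      fib_inv, star_sub, star_mul, ← B.fib_inv inv_one, ← unit_star_def, hes]
    noncomm_ring
  rw [e1, norm_fib]
  calc ‖(e * s - s) * e - (e * s - s)‖ ≤ ‖e * s - s‖ * ‖e‖ + ‖e * s - s‖ :=
        (norm_sub_le _ _).trans (add_le_add_left (_root_.norm_mul_le _ _) _)
    _ ≤ ‖e * s - s‖ * 1 + ‖e * s - s‖ := by gcongr
    _ = 2 * ‖e * s - s‖ := by ring

/-! ### Bundle maps as maps of `C_c(B)` into `C*(B)` -/

variable {B}

namespace BundleMap

/-- The linear map `C_c(B) → C*(B)` which sends `a ⊙ g` to the image of `T_g(a)`. -/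
def toFull (T : B.BundleMap) : B.Cc →ₗ[ℂ] B.FullCStar :=
  (show B.Cc →ₗ[ℂ] B.FullCStar from
    { toFun := B.kappa, map_add' := map_add B.kappa, map_smul' := map_smul B.kappa }).comp
    (show B.Cc →ₗ[ℂ] B.Cc from DFinsupp.mapRange.linearMap fun g => (T g).toLinearMap)

theorem toFull_j (T : B.BundleMap) {g : G} (a : B.Fib g) : T.toFull (B.j g a) = B.fib g (T g a) := by
  classical
  have : (DFinsupp.mapRange.linearMap fun g => (T g).toLinearMap) (DFinsupp.single g a) =
    DFinsupp.single g (T g a) := by simp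
  rw [fib_def]
  refine congrArg B.kappa (Eq.trans ?_ (this.trans ?_)) <;> (simp only [j]; congr!)

theorem norm_toFull_star_j_mul_j_le (T : B.BundleMap) {g h : G} (a : B.Fib g) (b : B.Fib h) :
    ‖T.toFull (star (B.j g a) * B.j h b)‖ ≤ ‖T (g⁻¹ * h)‖ * (‖a‖ * ‖b‖) := by
  rw [B.star_j rfl, B.j_mul_j rfl, toFull_j, norm_fib]
  refine ((T _).le_opNorm _).trans ?_
  gcongr
  refine (B.norm_mul_le _ _ _).trans_eq ?_
  rw [B.norm_inv]

theorem toFull_star_j_mul_j_mem (T : B.BundleMap) {g h : G} (a : B.Fib g) (b : B.Fib h) :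
    T.toFull (star (B.j g a) * B.j h b) ∈ LinearMap.range (B.fib (g⁻¹ * h)) := by
  rw [B.star_j rfl, B.j_mul_j rfl, toFull_j]
  exact ⟨_, rfl⟩

theorem IsPosDef.sum_nonneg {T : B.BundleMap} (hT : T.IsPosDef) {ι : Type*} [Fintype ι] (g : ι → G)
    (a b : ∀ i, B.Fib (g i)) :
    0 ≤ ∑ i, ∑ k, B.fib _ (b i) * T.toFull (star (B.j _ (a i)) * B.j _ (a k)) *
      star (B.fib _ (b k)) := by
  let e := Fintype.equivFin ι
  have h := B.fib_one_nonneg (hT _ (fun i => g (e.symm i)) (fun i => a (e.symm i))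
    fun i => b (e.symm i))
  rw [map_sum] at h
  simp only [map_sum, fib_mul, fib_inv, ← toFull_j] at h
  rw [← e.symm.sum_comp]
  refine h.trans_eq (Finset.sum_congr rfl fun i _ => ?_)
  rw [← e.symm.sum_comp]
  refine Finset.sum_congr rfl fun k _ => ?_
  rw [B.star_j rfl, B.j_mul_j rfl]

/-- A finitely supported bundle map is bounded with respect to the reduced norm. -/
theorem exists_norm_toFull_le (T : B.BundleMap) (hT : {g | T g ≠ 0}.Finite) :
    ∃ D, ∀ f, ‖T.toFull f‖ ≤ D * ‖B.iota f‖ := by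
  classical
  refine ⟨∑ g ∈ hT.toFinset, ‖T g‖, fun f => ?_⟩
  have h1 : T.toFull f = ∑ g ∈ hT.toFinset, B.fib g (T g (f g)) := by
    induction f using Cc.induction with
    | h0 => simp [Cc.zero_apply]
    | hadd f₁ f₂ h₁ h₂ => simp only [map_add, h₁, h₂, Cc.add_apply, Finset.sum_add_distrib]
    | hj g a =>
      rw [toFull_j, Finset.sum_eq_single g, B.j_apply_same]
      · intro h _ hh
        rw [B.j_apply_ne hh.symm, map_zero, map_zero]
      · intro hg
        have : T g = 0 := by simpa using hg
        simp [this]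
  rw [h1, Finset.sum_mul]
  refine (norm_sum_le _ _).trans (Finset.sum_le_sum fun g _ => ?_)
  rw [norm_fib]
  exact ((T g).le_opNorm _).trans (mul_le_mul_of_nonneg_left (B.norm_apply_le_norm_iota f g)
    (norm_nonneg _))

end BundleMap

end FellBundle

/-! ### Complete positivity and the Schwarz inequality -/

theorem sum_sum_sum_star_mul {R ι κ : Type*} [NonUnitalSemiring R] [StarRing R] [Fintype ι]
    [Fintype κ] (y : κ → ι → R) :
    ∑ i, ∑ l, ∑ m, star (y m i) * y m l = ∑ m, star (∑ i, y m i) * ∑ i, y m i := by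
  simp only [star_sum, Finset.sum_mul_sum]
  exact (Finset.sum_congr rfl fun i _ => Finset.sum_comm).trans Finset.sum_comm

namespace FellBundle

variable {G : Type u} [Group G] {B : FellBundle.{u, v} G}

/-- Splitting of `a* b` by an element `w` of the unit fibre with `1 - (1 - w)² = v c c* v`. -/
theorem star_j_mul_j_eq {g h k : G} (a : B.Fib g) (b : B.Fib h) (c : B.Fib k) {w v : B.Fib 1}
    (hw : star w = w) (hv : star v = v)
    (hwv : w + w - w * w = v * B.mul (mul_inv_cancel k) c (B.inv rfl c) * v) :
    star (B.j g a) * B.j h b =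
      star (B.j (k⁻¹ * g) (B.mul rfl (B.inv rfl (B.mul (one_mul k) v c)) a)) *
        B.j (k⁻¹ * h) (B.mul rfl (B.inv rfl (B.mul (one_mul k) v c)) b) +
      star (B.j g (a - B.mul (one_mul g) w a)) * B.j h (b - B.mul (one_mul h) w b) := by
  have hw' : star (B.j 1 w) = B.j 1 w := by rw [B.star_j inv_one]; exact congrArg _ hw
  have hv' : star (B.j 1 v) = B.j 1 v := by rw [B.star_j inv_one]; exact congrArg _ hv
  -- The right-hand side of the claim is `a* (v c c* v + (1 - w)²) b`, so this identity for `1 - (1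
  -- - w)²` is all that is needed.
  have e : B.j 1 w + B.j 1 w - B.j 1 w * B.j 1 w =
      B.j 1 v * (B.j k c * star (B.j k c)) * B.j 1 v := by
    rw [B.star_j rfl, B.j_mul_j (mul_inv_cancel k), B.j_mul_j (mul_one 1), B.j_mul_j (mul_one 1),
      B.j_mul_j (mul_one 1), ← map_add, ← map_sub]
    exact congrArg _ hwv
  simp only [map_sub, ← B.j_mul_j, ← B.star_j, star_sub, star_mul, star_star, hw', hv']
  have e' : star (B.j g a) * (B.j 1 w + B.j 1 w - B.j 1 w * B.j 1 w) * B.j h b =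
      star (B.j g a) * (B.j 1 v * (B.j k c * star (B.j k c)) * B.j 1 v) * B.j h b := by rw [e]
  have e2 : star (B.j g a) * (B.j 1 v * B.j k c) * (star (B.j k c) * B.j 1 v * B.j h b) =
      star (B.j g a) * (B.j 1 w + B.j 1 w - B.j 1 w * B.j 1 w) * B.j h b := by
    rw [e']; noncomm_ring
  rw [e2]
  noncomm_ring

/-- The right-hand side is `‖(1 - w) a a* (1 - w)‖`, multiplied out into the expression estimated by
`exists_approx_support`. -/
theorem norm_sub_mul_sq {g : G} (a : B.Fib g) {w : B.Fib 1} (hw : star w = w) :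
    ‖a - B.mul (one_mul g) w a‖ ^ 2 =
      ‖B.mul (mul_inv_cancel g) a (B.inv rfl a) - w * B.mul (mul_inv_cancel g) a (B.inv rfl a) -
        B.mul (mul_inv_cancel g) a (B.inv rfl a) * w +
        w * B.mul (mul_inv_cancel g) a (B.inv rfl a) * w‖ := by
  have hw' : star (B.fib 1 w) = B.fib 1 w := by rw [← B.fib_inv inv_one]; exact congrArg _ hw
  rw [← B.norm_mul_inv_self rfl (mul_inv_cancel g), ← B.norm_fib, ← B.norm_fib]
  congr 1
  rw [fib_mul, fib_inv]
  simp only [map_sub, map_add, unit_mul_def, fib_mul, fib_inv, star_sub, star_mul, hw']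
  noncomm_ring

theorem mul_inv_self_nonneg {g : G} (a : B.Fib g) :
    0 ≤ B.mul (mul_inv_cancel g) a (B.inv rfl a) := by
  have := B.inv_mul_self_nonneg (_root_.inv_inv g) (mul_inv_cancel g) (B.inv rfl a)
  rwa [B.inv_inv] at this

namespace BundleMap

variable {T : B.BundleMap} {ι : Type*} [Fintype ι]

/-- The quadratic form of a positive definite bundle map is positive on vectors of degree one, if it
is positive for all families whose `k`-th member vanishes. -/
theorem IsPosDef.sum_star_mul_nonneg [DecidableEq ι] (hT : T.IsPosDef) (g : ι → G)
    (a : ∀ i, B.Fib (g i)) (k : ι)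
    (ih : ∀ a' : ∀ i, B.Fib (g i), (∀ i, a i = 0 → a' i = 0) → a' k = 0 → ∀ x : ι → B.FullCStar,
      0 ≤ ∑ i, ∑ l, star (x i) * T.toFull (star (B.j _ (a' i)) * B.j _ (a' l)) * x l)
    (x : ι → B.FullCStar) (hx : ∀ i, x i ∈ LinearMap.range (B.fib ((g i)⁻¹ * g k))) :
    0 ≤ ∑ i, ∑ l, star (x i) * T.toFull (star (B.j _ (a i)) * B.j _ (a l)) * x l := by
  -- Applied to `s = a_k a_k*` with `ε = 1 / (n + 1)`, so that `‖(1 - w_n) a_k‖² ≤ 1 / (n + 1)`.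
  have hex := fun n : ℕ => exists_approx_support (mul_inv_self_nonneg (a k))
    (Nat.one_div_pos_of_nat (α := ℝ) (n := n))
  choose w v hw hv hw1 hwv hε using hex
  -- The remainder family `(1 - w_n) a_i`, followed by the same family with its small `k`-th member
  -- replaced by zero, to which the induction hypothesis applies.
  let a' : ℕ → ∀ i, B.Fib (g i) := fun n i => a i - B.mul (one_mul (g i)) (w n) (a i)
  let a'' : ℕ → ∀ i, B.Fib (g i) := fun n => Function.update (a' n) k 0
  have ha' : ∀ n i, ‖a' n i‖ ≤ 2 * ‖a i‖ := fun n i => by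
    refine (norm_sub_le _ _).trans ?_
    have := (B.norm_mul_le (one_mul (g i)) (w n) (a i)).trans
      (mul_le_mul_of_nonneg_right (hw1 n) (norm_nonneg _))
    linarith
  have hk : Filter.Tendsto (fun n => ‖a' n k‖) Filter.atTop (nhds 0) := by
    have h0 : Filter.Tendsto (fun n : ℕ => √(1 / ((n : ℝ) + 1))) Filter.atTop (nhds 0) := by
      simpa using (tendsto_one_div_add_atTop_nhds_zero_nat (𝕜 := ℝ)).sqrt
    refine squeeze_zero (fun _ => norm_nonneg _) (fun n => ?_) h0
    refine Real.le_sqrt_of_sq_le ?_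
    rw [norm_sub_mul_sq _ (hw n)]
    exact hε n
  -- The two families give different entries only in row and column `k`. There the entry of `a''` is
  -- zero and that of `a'` is bounded by a constant times `‖a' n k‖`.
  have hd : ∀ i l, Filter.Tendsto (fun n => T.toFull (star (B.j _ (a' n i)) * B.j _ (a' n l)) -
      T.toFull (star (B.j _ (a'' n i)) * B.j _ (a'' n l))) Filter.atTop (nhds 0) := by
    intro i l
    by_cases hi : i = k ∨ l = k
    · have hz : ∀ n, T.toFull (star (B.j _ (a'' n i)) * B.j _ (a'' n l)) = 0 := fun n => by
        rcases hi with rfl | rfl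
        · simp only [a'', Function.update_self, map_zero, star_zero, zero_mul]
        · simp only [a'', Function.update_self, map_zero, mul_zero]
      simp only [hz, sub_zero]
      refine squeeze_zero_norm (fun n => norm_toFull_star_j_mul_j_le T _ _) ?_
      rw [show (0 : ℝ) = ‖T ((g i)⁻¹ * g l)‖ * 0 by simp]
      refine Filter.Tendsto.const_mul _ ?_
      rcases hi with rfl | rfl
      · refine squeeze_zero (fun _ => by positivity)
          (fun n => mul_le_mul_of_nonneg_left (ha' n l) (norm_nonneg _)) ?_
        simpa using hk.mul_const (2 * ‖a l‖)
      · refine squeeze_zero (fun _ => by positivity)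
          (fun n => mul_le_mul_of_nonneg_right (ha' n i) (norm_nonneg _)) ?_
        simpa using hk.const_mul (2 * ‖a i‖)
    · rw [not_or] at hi
      simp [a'', Function.update_of_ne hi.1, Function.update_of_ne hi.2]
  have hsum : Filter.Tendsto (fun n => ∑ i, ∑ l, star (x i) * (T.toFull (star (B.j _ (a' n i)) *
      B.j _ (a' n l)) - T.toFull (star (B.j _ (a'' n i)) * B.j _ (a'' n l))) * x l)
      Filter.atTop (nhds 0) := by
    rw [show (0 : B.FullCStar) = ∑ i : ι, ∑ l : ι, star (x i) * 0 * x l by simp]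
    exact tendsto_finsetSum _ fun i _ => tendsto_finsetSum _ fun l _ =>
      ((hd i l).const_mul _).mul_const _
  choose y hy using hx
  -- Both `(v_n a_k)* a_i` and the adjoint of `x_i` lie in the fibre over `g_k⁻¹ g_i`, so the
  -- definition of positive definiteness applies to them.
  have hpd : ∀ n, 0 ≤ ∑ i, ∑ l, star (x i) * T.toFull (star (B.j ((g k)⁻¹ * g i)
      (B.mul rfl (B.inv rfl (B.mul (one_mul (g k)) (v n) (a k))) (a i))) *
        B.j ((g k)⁻¹ * g l) (B.mul rfl (B.inv rfl (B.mul (one_mul (g k)) (v n) (a k))) (a l))) *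
        x l := fun n => by
    have hg : ∀ i, ((g i)⁻¹ * g k)⁻¹ = (g k)⁻¹ * g i := fun i => by
      rw [mul_inv_rev, _root_.inv_inv]
    have h := hT.sum_nonneg (fun i => (g k)⁻¹ * g i)
      (fun i => B.mul rfl (B.inv rfl (B.mul (one_mul (g k)) (v n) (a k))) (a i))
      (fun i => B.inv (hg i) (y i))
    simpa only [fib_inv, star_star, hy] using h
  have hih : ∀ n, 0 ≤ ∑ i, ∑ l, star (x i) *
      T.toFull (star (B.j _ (a'' n i)) * B.j _ (a'' n l)) * x l := fun n => by
    refine ih (a'' n) (fun i hi => ?_) (Function.update_self _ _ _) x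
    by_cases hik : i = k
    · subst hik; exact Function.update_self _ _ _
    · simp only [a'', Function.update_of_ne hik, a', hi, map_zero, sub_zero]
  have hlim := (tendsto_const_nhds (x := ∑ i, ∑ l, star (x i) *
    T.toFull (star (B.j _ (a i)) * B.j _ (a l)) * x l) (f := Filter.atTop (α := ℕ))).sub hsum
  rw [sub_zero] at hlim
  -- The form of `a` is the sum of the `hpd` term and the form of `a'`. Subtracting the vanishing
  -- difference between the forms of `a'` and `a''` leaves a sum of two positive terms, and the
  -- positive cone is closed.
  refine ge_of_tendsto' hlim fun n => ?_
  refine (add_nonneg (hpd n) (hih n)).trans_eq ?_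
  rw [← Finset.sum_add_distrib, ← Finset.sum_sub_distrib]
  refine Finset.sum_congr rfl fun i _ => ?_
  rw [← Finset.sum_add_distrib, ← Finset.sum_sub_distrib]
  refine Finset.sum_congr rfl fun l _ => ?_
  have e := star_j_mul_j_eq (a i) (a l) (a k) (hw n) (hv n) (hwv n)
  change _ = _ + star (B.j _ (a' n i)) * B.j _ (a' n l) at e
  rw [e, map_add, mul_add, add_mul, mul_sub, sub_mul]
  abel

/-- Complete positivity of positive definite bundle maps: the matrix with the entries
`T_{g_i⁻¹ g_k}(a_i* a_k)` is positive over `C*(B)`. -/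
theorem IsPosDef.exists_eq_star_mul_self (hT : T.IsPosDef) (g : ι → G) (a : ∀ i, B.Fib (g i)) :
    ∃ R : CStarMatrix ι ι B.FullCStar, ∀ i k,
      T.toFull (star (B.j _ (a i)) * B.j _ (a k)) = ∑ l, star (R l i) * R l k := by
  classical
  -- Strong induction on a set `s` outside which the family vanishes. Members are replaced by zero
  -- and never removed, so the index set and the degrees `g_i` stay fixed.
  suffices h : ∀ (s : Finset ι) (a : ∀ i, B.Fib (g i)), (∀ i, i ∉ s → a i = 0) →
      ∃ R : CStarMatrix ι ι B.FullCStar, ∀ i k,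
        T.toFull (star (B.j _ (a i)) * B.j _ (a k)) = ∑ l, star (R l i) * R l k from
    h Finset.univ a fun i hi => absurd (Finset.mem_univ i) hi
  intro s
  induction s using Finset.strongInduction with
  | H s ih =>
  intro a ha
  let Y : CStarMatrix ι ι B.FullCStar :=
    CStarMatrix.ofMatrix fun i k => T.toFull (star (B.j _ (a i)) * B.j _ (a k))
  have hY : ∀ i k, Y i k = T.toFull (star (B.j _ (a i)) * B.j _ (a k)) := fun _ _ => rfl
  obtain ⟨R, hR⟩ := exists_star_mul_self_of_graded (fun g => LinearMap.range (B.fib g))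
    B.mul_mem_range_fib B.star_mem_range_fib B.isClosed_range_fib g s Y
    (fun i k => toFull_star_j_mul_j_mem T _ _)
    (fun i k hi => by rw [hY, ha i hi]; simp) (fun i k hk => by rw [hY, ha k hk]; simp)
    (fun k hk x hx => by
      refine hT.sum_star_mul_nonneg g a k (fun a' h0 hk' x => ?_) x hx
      -- The factorization for the smaller support makes the form of `a'` a sum of elements `y* y`
      -- for every vector `x`, without any homogeneity of `x`.
      obtain ⟨R, hR⟩ := ih (s.erase k) (Finset.erase_ssubset hk) a' fun i hi => by
        by_cases hik : i = k
        · subst hik; exact hk'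
        · exact h0 i (ha i fun his => hi (Finset.mem_erase.2 ⟨hik, his⟩))
      have e : ∑ i, ∑ l, star (x i) * T.toFull (star (B.j _ (a' i)) * B.j _ (a' l)) * x l =
          ∑ m, star (∑ i, R m i * x i) * ∑ i, R m i * x i := by
        rw [← sum_sum_sum_star_mul]
        simp only [hR, star_mul, Finset.mul_sum, Finset.sum_mul, _root_.mul_assoc]
      rw [e]
      exact Finset.sum_nonneg fun m _ => star_mul_self_nonneg _)
  refine ⟨R, fun i k => ?_⟩
  rw [← hY, hR, CStarMatrix.mul_apply]
  simp only [CStarMatrix.star_apply]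

/-- The Schwarz inequality for positive definite bundle maps. -/
theorem IsPosDef.norm_toFull_sq_le (hT : T.IsPosDef) {C : ℝ} (hC : ‖T 1‖ ≤ C) (f : B.Cc) :
    ‖T.toFull f‖ ^ 2 ≤ C * ‖T.toFull (star f * f)‖ := by
  classical
  have hl := CStarAlgebra.increasingApproximateUnit (B.Fib 1)
  have h1 : ∀ e : B.Fib 1, ‖e‖ ≤ 1 →
      ‖T.toFull (star (B.j 1 e) * f)‖ ^ 2 ≤ C * ‖T.toFull (star f * f)‖ := by
    intro e he
    let S : Finset G := DFinsupp.support f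
    -- The index `none` carries `e` in degree one, and the other indices carry the values of `f`. A
    -- single factorization thus covers `e* e`, `e* f` and `f* f`, and Cauchy–Schwarz for the
    -- columns of `R` gives the inequality with `e* f` in place of `f`.
    let g : Option S → G := fun o => o.elim 1 Subtype.val
    let a : ∀ o, B.Fib (g o) := fun o => match o with
      | none => e
      | some i => f i
    obtain ⟨R, hR⟩ := hT.exists_eq_star_mul_self g a
    have hf : ∑ i : S, B.j (g (some i)) (a (some i)) = f := by
      conv_rhs => rw [← B.sum_j f]
      exact Finset.sum_coe_sort S fun i => B.j i (f i)
    have e0 : T.toFull (star (B.j 1 e) * B.j 1 e) = ∑ l, star (R l none) * R l none :=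
      hR none none
    have e1 : T.toFull (star (B.j 1 e) * f) = ∑ l, star (R l none) * ∑ i : S, R l (some i) := by
      conv_lhs => rw [← hf, Finset.mul_sum, map_sum]
      simp only [Finset.mul_sum]
      rw [Finset.sum_comm]
      exact Finset.sum_congr rfl fun i _ => hR none (some i)
    have e2 : T.toFull (star f * f) =
        ∑ l, star (∑ i : S, R l (some i)) * ∑ i : S, R l (some i) := by
      conv_lhs => rw [← hf, star_sum, Finset.sum_mul, map_sum]
      rw [← sum_sum_sum_star_mul]
      simp only [Finset.mul_sum, map_sum, hR]
    rw [e1, e2]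
    refine (norm_sum_star_mul_sq_le _ _).trans (mul_le_mul_of_nonneg_right ?_ (norm_nonneg _))
    rw [← e0]
    have : ‖T.toFull (star (B.j 1 e) * B.j 1 e)‖ ≤ ‖T 1‖ * (‖e‖ * ‖e‖) := by
      have h := norm_toFull_star_j_mul_j_le T e e
      rwa [inv_one, mul_one] at h
    calc _ ≤ _ := this
      _ ≤ ‖T 1‖ * (1 * 1) := by gcongr
      _ ≤ C := by simpa using hC
  -- Letting `e` run through an approximate unit of `B_e` removes it. Continuity of each single
  -- `T_g` is enough, since `f` is finitely supported.
  have h2 : ∀ f, Filter.Tendsto (fun e : B.Fib 1 => T.toFull (B.j 1 e * f))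
      (CStarAlgebra.approximateUnit (B.Fib 1)) (nhds (T.toFull f)) := by
    intro f
    induction f using Cc.induction with
    | h0 => simp
    | hadd f₁ f₂ h₁ h₂ => simpa only [mul_add, map_add] using h₁.add h₂
    | hj g a =>
      simp only [B.j_mul_j (one_mul g), toFull_j]
      have hc : Continuous fun b : B.Fib g => B.fib g (T g b) :=
        (AddMonoidHomClass.isometry_of_norm (B.fib g) fun a => B.norm_fib a).continuous.comp
          (T g).continuous
      exact (hc.tendsto a).comp (B.tendsto_mul_approximateUnit a)
  refine le_of_tendsto ((h2 f).norm.pow 2) ?_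
  filter_upwards [hl.eventually_norm, hl.eventually_star_eq] with e he hes
  have h := h1 e he
  rwa [B.star_j inv_one, ← unit_star_def, hes] at h

end BundleMap

end FellBundle

/-! ### The lower bound for `Λ` and the conclusion -/

namespace FellBundle

variable {G : Type u} [Group G] {B : FellBundle.{u, v} G}

/-- A finitely supported positive definite bundle map induces a bounded map from the reduced to the
full cross-sectional C⋆-algebra. -/
theorem BundleMap.IsPosDef.norm_toFull_le {T : B.BundleMap} (hT : T.IsPosDef)
    (hfin : {g | T g ≠ 0}.Finite) {C : ℝ} (hC0 : 0 < C) (hC : ‖T 1‖ ≤ C) (f : B.Cc) :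
    ‖T.toFull f‖ ≤ C * ‖B.iota f‖ := by
  obtain ⟨D, hD⟩ := T.exists_norm_toFull_le hfin
  exact le_mul_of_sq_le_of_le (N := fun f => ‖T.toFull f‖) (r := fun f => ‖B.iota f‖)
    (fun _ => norm_nonneg _) hC0 (hT.norm_toFull_sq_le hC) hD
    (fun f => B.redSeminorm.star_mul_self' f) f

theorem HasPDApproximationProperty.exists_norm_le
    (hB : FellBundle.HasPDApproximationProperty.{u, v, w} B) :
    ∃ C, 0 < C ∧ ∀ x : B.FullCStar, ‖x‖ ≤ C * ‖B.Lambda x‖ := by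
  obtain ⟨I, _, _, _, T, hT, ⟨C, hC⟩, hlim⟩ := hB
  -- The maximum makes the constant strictly positive, as the iteration of the Schwarz inequality
  -- requires.
  refine ⟨max C 1, by positivity, fun x => ?_⟩
  have hcont : Continuous B.Lambda := by
    refine AddMonoidHomClass.continuous_of_bound B.Lambda 1 fun x => ?_
    rw [one_mul]
    exact NonUnitalStarAlgHom.norm_apply_le B.Lambda x
  refine B.uSeminorm.denseRange_toCompletionHom.induction_on
    (p := fun x => ‖x‖ ≤ max C 1 * ‖B.Lambda x‖) x
    (isClosed_le continuous_norm (continuous_const.mul hcont.norm)) fun f => ?_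
  change ‖B.kappa f‖ ≤ max C 1 * ‖(B.Lambda (B.kappa f)).1‖
  rw [Lambda_kappa]
  -- On `a ⊙ g` this is the pointwise convergence of the net, because the fibres embed
  -- isometrically. It extends to finite sums by additivity.
  have h : ∀ f : B.Cc, Filter.Tendsto (fun i => (T i).toFull f) Filter.atTop (nhds (B.kappa f)) := by
    intro f
    induction f using Cc.induction with
    | h0 => simp
    | hadd f₁ f₂ h₁ h₂ => simpa only [map_add] using h₁.add h₂
    | hj g a =>
      rw [tendsto_iff_norm_sub_tendsto_zero]
      refine (hlim g a).congr fun i => ?_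
      rw [BundleMap.toFull_j, ← fib_def, ← map_sub, norm_fib]
  exact le_of_tendsto' (h f).norm fun i =>
    (hT i).1.norm_toFull_le (hT i).2 (by positivity) ((hC i).trans (le_max_left _ _)) f

/-- A map that is bounded below on a complete space has closed range, and the range contains
`ι(C_c(B))`, which is dense in `C_r*(B)` by definition. -/
theorem surjective_Lambda_of_norm_le {C : ℝ} (hC : 0 < C)
    (h : ∀ x : B.FullCStar, ‖x‖ ≤ C * ‖B.Lambda x‖) : Function.Surjective B.Lambda := by
  have hcl : IsClosed (Set.range B.Lambda) := by
    have hu : UniformContinuous B.Lambda := by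
      refine (AddMonoidHomClass.lipschitz_of_bound B.Lambda 1 fun x => ?_).uniformContinuous
      rw [one_mul]
      exact NonUnitalStarAlgHom.norm_apply_le B.Lambda x
    have ha : AntilipschitzWith ⟨C, hC.le⟩ B.Lambda :=
      AddMonoidHomClass.antilipschitz_of_bound B.Lambda h
    exact ha.isClosed_range hu
  have hd : DenseRange B.Lambda := by
    intro y
    have hy := y.2
    have : closure (Set.range B.iota) = (B.redSubalgebra : Set B.Adj) := rfl
    rw [← SetLike.mem_coe, ← this] at hy
    rw [mem_closure_iff_seq_limit] at hy ⊢
    obtain ⟨z, hz, hlim⟩ := hy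
    choose f hf using hz
    refine ⟨fun n => B.Lambda (B.kappa (f n)), fun n => ⟨_, rfl⟩, ?_⟩
    refine tendsto_subtype_rng.2 ?_
    exact hlim.congr fun n => by rw [← hf, ← Lambda_kappa]
  intro y
  have := hd y
  rwa [hcl.closure_eq] at this

end FellBundle

end

theorem theorem5p4 {G : Type u} [Group G] (B : FellBundle.{u, v} G)
    (hB : FellBundle.HasPDApproximationProperty.{u, v, w} B) :
    B.HasWCP ∧ ∃ Φ : B.FullCStar ≃⋆ₐ[ℂ] B.RedCStar, ∀ x, Φ x = B.Lambda x := by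
  obtain ⟨C, hC, h⟩ := hB.exists_norm_le
  have hinj : Function.Injective B.Lambda := (injective_iff_map_eq_zero B.Lambda).2 fun x hx => by
    have := h x
    rwa [hx, norm_zero, mul_zero, norm_le_zero_iff] at this
  exact ⟨hinj, StarAlgEquiv.ofBijective B.Lambda
    ⟨hinj, FellBundle.surjective_Lambda_of_norm_le hC h⟩, fun _ => rfl⟩
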